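/- **Theorem 5.1.** Let $n\ge 3$. Then $TP_{CG}(n)\subsetneq TP(n)$. Here $TP(n)$ is the set of totally positive elements of $GL_n(\mathbb C)$, i.e. of matrices all of whose minors are positive (real) numbers, and $TP_{CG}(n)\subset GL_n(\mathbb C)$ is the positive locus of the Cremmer–Gervais cluster structure $\mathcal C_{CG}(n)$ on $n\times n$ matrices: the set of all $X\in GL_n(\mathbb C)$ at which the functions forming a single extended cluster of $\mathcal C_{CG}(n)$ are defined and take positive (real) values. The structure $\mathcal C_{CG}(n)$ is the set of all seeds in the field $\mathbb C(x_{ij})_{1\le i,j\le n}$ obtained by finite sequences of seed mutations from the following initial seed. Mutation of an extended cluster $(x_v)$ with extended exchange matrix $(b_{uv})$ ($u$ mutable, $v$ arbitrary) in a mutable direction $k$ replaces $x_k$ by $x_k'$, where $x_kx_k'=\prod_{b_{kv}>0}x_v^{b_{kv}}+\prod_{b_{kv}<0}x_v^{-b_{kv}}$, and $b_{uv}$ by $-b_{uv}$ if $u=k$ or $v=k$, and by $b_{uv}+\tfrac12\left(|b_{uk}|b_{kv}+b_{uk}|b_{kv}|\right)$ otherwise. *Initial extended cluster.* Let $X=(x_{ij})$,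 $k=\lfloor\frac{n+1}2\rfloor$, $N=k(n-1)$, and $M=N$ for $n$ even, $M=N-n+1$ for $n$ odd. Put $\mathcal X=[X_{[2,n]}\ \ 0]$ and $\mathcal Y=[0\ \ X_{[1,n-1]}]$; these are $(n-1)\times(n+1)$ matrices formed by the last, respectively first, $n-1$ rows of $X$ and a zero column. Let $U$ be the $k(n-1)\times(k+1)(n+1)$ block matrix with $k\times(k+1)$ blocks of size $(n-1)\times(n+1)$ whose $a$-th block row has $\mathcal Y$ in block column $a$, $\mathcal X$ in block column $a+1$, and zeros elsewhere. With lower indices denoting rows and upper indices denoting columns, set $$\theta_i=\det X_{[n-i+1,n]}^{[n-i+1,n]}\ (1\le i\le n),\qquad \varphi_p=\det U_{[N-p+1,N]}^{[k(n+1)-p+1,\,k(n+1)]}\ (1\le p\le N),$$ $$\psi_q=\det U_{[N-q+1,N]}^{[k(n+1)-q+2,\,k(n+1)+1]}\ (1\le q\le M).$$ The stable (frozen) variables are $\theta_n=\det X$, $\varphi_N$ and $\psi_M$; all other functions are mutable. *Initial quiver.* Each of these $n^2$ functions is placed at the vertex $(i,j)\in[1,n]^2$ such that $x_{ij}$ is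 the upper left entry of the submatrix in its definition; every vertex is used exactly once. The arrows are: $(i,j+1)\to(i,j)$ for $1\le i\le n$, $1\le j\le n-1$, $(i,j)\ne(1,n-1)$; $(i+1,j)\to(i,j)$ for $1\le i\le n-1$, $1\le j\le n$, $(i,j)\neq(1,1)$; $(i,j)\to(i+1,j+1)$ for $1\le i,j\le n-1$; $(n,j)\to(1,j)$ and $(1,j)\to(n,j+1)$ for $2\le j\le n-1$; $(i,n)\to(i+2,1)$ and $(i+2,1)\to(i+1,n)$ for $1\le i\le n-2$. The initial exchange matrix has $b_{uv}=1$ for an arrow $u\to v$, $b_{uv}=-1$ for an arrow $v\to u$, and $b_{uv}=0$ otherwise. -/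

import Mathlib

open scoped ComplexOrder

noncomputable section

/-! ### Seeds, mutations and cluster structures -/

/-- The data of a seed of geometric type in a field `K`: the mutable vertices (cluster variables)
are indexed by `I`, the frozen vertices (stable variables) by `F`; `x` is the extended cluster and
`B` the extended exchange matrix. -/
structure Seed (I F K : Type*) where
  /-- the extended cluster -/
  x : I ⊕ F → K
  /-- the extended exchange matrix -/
  B : Matrix I (I ⊕ F) ℤ

namespace Seed

variable {I F K : Type*} [Fintype I] [Fintype F] [DecidableEq I] [DecidableEq F] [Field K]

/-- The new cluster variable `x'ₖ`, defined by the exchange relation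
`xₖ x'ₖ = ∏_{bₖᵢ > 0} xᵢ ^ bₖᵢ + ∏_{bₖᵢ < 0} xᵢ ^ (-bₖᵢ)`. -/
def newVariable (s : Seed I F K) (k : I) : K :=
  ((∏ i, s.x i ^ (s.B k i).toNat) + ∏ i, s.x i ^ (-s.B k i).toNat) / s.x (Sum.inl k)

/-- Matrix mutation in direction `k`. -/
def mutateMatrix (B : Matrix I (I ⊕ F) ℤ) (k : I) : Matrix I (I ⊕ F) ℤ :=
  Matrix.of fun i j =>
    if i = k ∨ j = Sum.inl k then -B i j
    else B i j + (|B i (Sum.inl k)| * B k j + B i (Sum.inl k) * |B k j|) / 2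

/-- The seed adjacent to `s` in direction `k`. -/
def mutate (s : Seed I F K) (k : I) : Seed I F K where
  x := Function.update s.x (Sum.inl k) (s.newVariable k)
  B := mutateMatrix s.B k

/-- The cluster structure `𝒞(s)`: the set of all seeds that can be reached from `s` by a finite
sequence of mutations. -/
def clusterStructure (s : Seed I F K) : Set (Seed I F K) :=
  {s' | Relation.ReflTransGen (fun a b => ∃ k, b = a.mutate k) s s'}

end Seed

/-! ### Rational functions on the space of matrices -/

/-- The field `ℂ(Mat_n)` of rational functions in the matrix entries. -/
abbrev RatFun (n : ℕ) : Type := FractionRing (MvPolynomial (Fin n × Fin n) ℂ)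

/-- The generic `n × n` matrix, whose entries are the coordinate functions `x_{ij}`. -/
def genericMatrix (n : ℕ) : Matrix (Fin n) (Fin n) (RatFun n) :=
  Matrix.of fun i j => algebraMap (MvPolynomial (Fin n × Fin n) ℂ) (RatFun n) (MvPolynomial.X (i, j))

/-- The value of a polynomial in the matrix entries at a matrix `X`. -/
def evalAt {n : ℕ} (X : Matrix (Fin n) (Fin n) ℂ) (p : MvPolynomial (Fin n × Fin n) ℂ) : ℂ :=
  MvPolynomial.eval (fun ij => X ij.1 ij.2) p

/-- The rational function `f` is defined at the matrix `X`, and its value there is a positive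
(real) number. -/
def PositiveAt {n : ℕ} (f : RatFun n) (X : Matrix (Fin n) (Fin n) ℂ) : Prop :=
  ∃ a b : MvPolynomial (Fin n × Fin n) ℂ,
    evalAt X b ≠ 0 ∧
    f = algebraMap (MvPolynomial (Fin n × Fin n) ℂ) (RatFun n) a /
        algebraMap (MvPolynomial (Fin n × Fin n) ℂ) (RatFun n) b ∧
    0 < evalAt X a / evalAt X b

/-- The subset of `GL_n(ℂ)` on which all functions of the extended cluster of `s` are positive. -/
def Seed.positiveSet {n : ℕ} {I F : Type*} (s : Seed I F (RatFun n)) : Set (GL (Fin n) ℂ) :=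
  {X | ∀ v, PositiveAt (s.x v) (X : Matrix (Fin n) (Fin n) ℂ)}

/-! ### The initial seed of the Cremmer–Gervais cluster structure

All row and column numbers below start from `1`, as is usual for matrices. -/

/-- The `(i, j)` entry of an `n × n` matrix, `1 ≤ i, j ≤ n`; it is `0` outside that range. -/
def entry {R : Type*} [Zero R] {n : ℕ} (A : Matrix (Fin n) (Fin n) R) (i j : ℕ) : R :=
  if h : (1 ≤ i ∧ i ≤ n) ∧ (1 ≤ j ∧ j ≤ n) then A ⟨i - 1, by omega⟩ ⟨j - 1, by omega⟩ else 0

/-- The determinant of the `p × p` submatrix of `A` with rows `r, …, r + p - 1` and columns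
`c, …, c + p - 1`. -/
def denseMinor {R : Type*} [CommRing R] (A : ℕ → ℕ → R) (r c p : ℕ) : R :=
  Matrix.det (Matrix.of fun s t : Fin p => A (r + s) (c + t))

/-- `k = ⌊(n + 1) / 2⌋`. -/
def cgk (n : ℕ) : ℕ := (n + 1) / 2

/-- `N = k (n - 1)`. -/
def cgN (n : ℕ) : ℕ := cgk n * (n - 1)

/-- `M = N` if `n` is even and `M = N - n + 1` if `n` is odd. -/
def cgM (n : ℕ) : ℕ := if Even n then cgN n else cgN n - (n - 1)

/-- The number of the block that contains the `i`-th row (column), where the rows (columns) are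
cut into consecutive blocks of length `d`; blocks are numbered from `1`. -/
def blockNo (d i : ℕ) : ℕ := (i - 1) / d + 1

/-- The number of the `i`-th row (column) inside its block of length `d`. -/
def inBlock (d i : ℕ) : ℕ := (i - 1) % d + 1

/-- The `(n - 1) × (n + 1)` matrix `𝒳 = [X_{[2,n]} 0]`. -/
def calX {R : Type*} [Zero R] {n : ℕ} (X : Matrix (Fin n) (Fin n) R) (i j : ℕ) : R :=
  entry X (i + 1) j

/-- The `(n - 1) × (n + 1)` matrix `𝒴 = [0 Y_{[1,n-1]}]`. -/
def calY {R : Type*} [Zero R] {n : ℕ} (Y : Matrix (Fin n) (Fin n) R) (i j : ℕ) : R :=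
  entry Y i (j - 1)

/-- The `k (n - 1) × (k + 1) (n + 1)` matrix `U(X, Y)`: it consists of `k × (k + 1)` blocks of
size `(n - 1) × (n + 1)`; the `a`-th block row has `𝒴` as its `a`-th and `𝒳` as its
`(a + 1)`-st block, and all its other blocks are zero. -/
def cgU {R : Type*} [Zero R] {n : ℕ} (X Y : Matrix (Fin n) (Fin n) R) (i j : ℕ) : R :=
  if blockNo (n + 1) j = blockNo (n - 1) i then
    calY Y (inBlock (n - 1) i) (inBlock (n + 1) j)
  else if blockNo (n + 1) j = blockNo (n - 1) i + 1 then
    calX X (inBlock (n - 1) i) (inBlock (n + 1) j)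
  else 0

/-- Names of the functions `θ_i`, `φ_p`, `ψ_q`. -/
inductive CGName : Type
  | theta (i : ℕ)
  | phi (p : ℕ)
  | psi (q : ℕ)

/-- The functions `θ_i(X)`, `φ_p(X, Y)`, `ψ_q(X, Y)`. -/
def CGName.fn {R : Type*} [CommRing R] {n : ℕ} (X Y : Matrix (Fin n) (Fin n) R) : CGName → R
  | .theta i => denseMinor (entry X) (n - i + 1) (n - i + 1) i
  | .phi p => denseMinor (cgU X Y) (cgN n - p + 1) (cgk n * (n + 1) - p + 1) p
  | .psi q => denseMinor (cgU X Y) (cgN n - q + 1) (cgk n * (n + 1) - q + 2) q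

/-- The pair `(i, j)` such that the matrix entry `x_{ij}` stands in row `r` and column `c` of
`U(X, X)`. -/
def cgUPosition (n r c : ℕ) : ℕ × ℕ :=
  if blockNo (n + 1) c = blockNo (n - 1) r then
    (inBlock (n - 1) r, inBlock (n + 1) c - 1)
  else
    (inBlock (n - 1) r + 1, inBlock (n + 1) c)

/-- The vertex `ρ(f)` of the `n × n` grid assigned to a function `f`: the pair `(i, j)` such that
`x_{ij}` is the upper left entry of the submatrix whose determinant is `f`. -/
def CGName.position (n : ℕ) : CGName → ℕ × ℕ
  | .theta i => (n - i + 1, n - i + 1)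
  | .phi p => cgUPosition n (cgN n - p + 1) (cgk n * (n + 1) - p + 1)
  | .psi q => cgUPosition n (cgN n - q + 1) (cgk n * (n + 1) - q + 2)

/-- The arrows of the quiver `Q_CG(n)`; its vertices are the pairs `(i, j)` with
`1 ≤ i, j ≤ n`. -/
inductive CGArrow (n : ℕ) : ℕ × ℕ → ℕ × ℕ → Prop
  /-- horizontal arrows -/
  | horizontal (i j : ℕ) (hi : i ∈ Finset.Icc 1 n) (hj : j ∈ Finset.Icc 1 (n - 1))
      (h : (i, j) ≠ (1, n - 1)) : CGArrow n (i, j + 1) (i, j)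
  /-- vertical arrows -/
  | vertical (i j : ℕ) (hi : i ∈ Finset.Icc 1 (n - 1)) (hj : j ∈ Finset.Icc 1 n)
      (h : (i, j) ≠ (1, 1)) : CGArrow n (i + 1, j) (i, j)
  /-- diagonal arrows -/
  | diagonal (i j : ℕ) (hi : i ∈ Finset.Icc 1 (n - 1)) (hj : j ∈ Finset.Icc 1 (n - 1)) :
      CGArrow n (i, j) (i + 1, j + 1)
  /-- arrows from the last row to the first row -/
  | lastRowFirstRow (j : ℕ) (hj : j ∈ Finset.Icc 2 (n - 1)) : CGArrow n (n, j) (1, j)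
  /-- arrows from the first row to the last row -/
  | firstRowLastRow (j : ℕ) (hj : j ∈ Finset.Icc 2 (n - 1)) : CGArrow n (1, j) (n, j + 1)
  /-- arrows from the last column to the first column -/
  | lastColFirstCol (i : ℕ) (hi : i ∈ Finset.Icc 1 (n - 2)) : CGArrow n (i, n) (i + 2, 1)
  /-- arrows from the first column to the last column -/
  | firstColLastCol (i : ℕ) (hi : i ∈ Finset.Icc 1 (n - 2)) : CGArrow n (i + 2, 1) (i + 1, n)

open Classical in
/-- The entry `b_{uv}` of the exchange matrix: `1` for an arrow `u → v`, `-1` for an arrow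
`v → u`, and `0` if there is none. -/
def cgB (n : ℕ) (u v : ℕ × ℕ) : ℤ :=
  (if CGArrow n u v then 1 else 0) - (if CGArrow n v u then 1 else 0)

/-- Indices of the cluster variables `θ_1, …, θ_{n-1}`, `φ_1, …, φ_{N-1}`, `ψ_1, …, ψ_{M-1}`. -/
abbrev CGMutable (n : ℕ) : Type := Fin (n - 1) ⊕ Fin (cgN n - 1) ⊕ Fin (cgM n - 1)

/-- The functions of the initial extended cluster; the three stable variables are
`θ_n = det X`, `φ_N` and `ψ_M`. -/
def cgName (n : ℕ) : CGMutable n ⊕ Fin 3 → CGName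
  | .inl (.inl i) => .theta (i + 1)
  | .inl (.inr (.inl p)) => .phi (p + 1)
  | .inl (.inr (.inr q)) => .psi (q + 1)
  | .inr 0 => .theta n
  | .inr 1 => .phi (cgN n)
  | .inr 2 => .psi (cgM n)

/-- The initial seed of the Cremmer–Gervais cluster structure `𝒞_CG(n)` on `n × n` matrices: the
functions `θ_i(X)`, `φ_p(X, X)`, `ψ_q(X, X)` with the quiver `Q_CG(n)`. -/
def cgSeed (n : ℕ) : Seed (CGMutable n) (Fin 3) (RatFun n) where
  x v := (cgName n v).fn (genericMatrix n) (genericMatrix n)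
  B := Matrix.of fun u v =>
    cgB n ((cgName n (Sum.inl u)).position n) ((cgName n v).position n)

/-! ### The two sets of matrices -/

/-- The positive locus `TP_CG(n)` in `GL_n` of the Cremmer–Gervais cluster structure: the
elements on which the functions that form a single extended cluster take positive values. -/
def TPCG (n : ℕ) : Set (GL (Fin n) ℂ) :=
  {X | ∃ s ∈ (cgSeed n).clusterStructure, X ∈ s.positiveSet}

/-- The set `TP(n)` of totally positive elements of `GL_n`: all minors are positive. -/
def TP (n : ℕ) : Set (GL (Fin n) ℂ) :=
  {X | ∀ (m : ℕ) (r c : Fin m ↪o Fin n),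
    0 < ((X : Matrix (Fin n) (Fin n) ℂ).submatrix r c).det}

end

/-! ### Positivity in `ℂ` and positivity of rational functions at a matrix -/

/-! Inclusion. Exchange relations are subtraction-free, so positivity of one extended cluster at `X`
passes to every adjacent cluster and finally to the initial one: all θ, φ, ψ are positive at `X`.
Let Ξ be `X` with its rows in reverse order; the goal is `IsRevTP Ξ`. Read from the lower right
corner, the φ and ψ are leading minors of a staircase matrix built from two copies of Ξ
(`stairDet`). Write τ for `shift`. For lower unitriangular V, C, block row and column operations
replace the two copies by A = V Ξ τ(C) and B = τ(V) Ξ C without changing these minors. If A and B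
are upper triangular in their first m columns, the staircase is block triangular in a suitable order
of its indices, and its minors factor into minors of A and of B. The positivity of these factors is
what is needed to clear column m as well (`StairPos.exists_upperTo`).

Once A and B are upper triangular, put T = τ(V) Ξ τ(C). Minors of T in the first rows are minors of
A, minors in the last columns are minors of B, and the corner minors are the θ. After reversal of
columns these are all the initial minors, so by Desnanot–Jacobi and Fekete's criterion T is totally
positive up to row reversal (`StairPos.isRevTP`).

It remains to return from T to Ξ (`IsRevTP.of_shift_mul`). With P = V⁻¹ and Q = C⁻¹ one has T =
(τ(V) P) A, so Neville elimination writes τ(V) P as a product of elementary matrices with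
nonnegative parameters. Iterating P = τ(P) (τ(V) P) until the iterated shift of P is 1 gives the
same for P, and symmetrically for Q. Now Ξ = τ(P) T τ(Q), and such factors preserve the positivity.

Strictness. The matrix with entries 2^(ij) is totally positive by Vandermonde and Fekete, but ψ₂,
which is not a minor of `X`, is negative there. -/

theorem complex_inv_pos {z : ℂ} (h : 0 < z) : 0 < z⁻¹ := by
  obtain ⟨r, hr, rfl⟩ : ∃ r : ℝ, 0 < r ∧ (r : ℂ) = z := by
    rw [Complex.lt_def] at h
    exact ⟨z.re, h.1, Complex.ext rfl (by simpa using h.2)⟩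
  rw [← Complex.ofReal_inv]
  exact_mod_cast inv_pos.mpr hr

theorem complex_div_pos {z w : ℂ} (hz : 0 < z) (hw : 0 < w) : 0 < z / w := by
  rw [div_eq_mul_inv]
  exact mul_pos hz (complex_inv_pos hw)

theorem complex_pos_of_mul_pos {z w : ℂ} (h : 0 < z * w) (hw : 0 < w) : 0 < z := by
  have := complex_div_pos h hw
  rwa [mul_div_cancel_right₀ _ hw.ne'] at this

section PositiveAt

variable {n : ℕ} {X : Matrix (Fin n) (Fin n) ℂ}

theorem evalAt_mul (p q : MvPolynomial (Fin n × Fin n) ℂ) :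
    evalAt X (p * q) = evalAt X p * evalAt X q := by simp [evalAt]

theorem evalAt_add (p q : MvPolynomial (Fin n × Fin n) ℂ) :
    evalAt X (p + q) = evalAt X p + evalAt X q := by simp [evalAt]

theorem ne_zero_of_evalAt_ne_zero {b : MvPolynomial (Fin n × Fin n) ℂ} (hb : evalAt X b ≠ 0) :
    algebraMap (MvPolynomial (Fin n × Fin n) ℂ) (RatFun n) b ≠ 0 := by
  intro h
  rw [map_eq_zero_iff _ (IsFractionRing.injective _ _)] at h
  simp [h, evalAt] at hb

theorem PositiveAt.mul {f g : RatFun n} (hf : PositiveAt f X) (hg : PositiveAt g X) :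
    PositiveAt (f * g) X := by
  obtain ⟨a, b, hb, rfl, hp⟩ := hf
  obtain ⟨c, d, hd, rfl, hq⟩ := hg
  refine ⟨a * c, b * d, ?_, ?_, ?_⟩
  · rw [evalAt_mul]; exact mul_ne_zero hb hd
  · rw [map_mul, map_mul, div_mul_div_comm]
  · rw [evalAt_mul, evalAt_mul, ← div_mul_div_comm]; exact mul_pos hp hq

theorem PositiveAt.add {f g : RatFun n} (hf : PositiveAt f X) (hg : PositiveAt g X) :
    PositiveAt (f + g) X := by
  obtain ⟨a, b, hb, rfl, hp⟩ := hf
  obtain ⟨c, d, hd, rfl, hq⟩ := hg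
  refine ⟨a * d + b * c, b * d, ?_, ?_, ?_⟩
  · rw [evalAt_mul]; exact mul_ne_zero hb hd
  · rw [div_add_div _ _ (ne_zero_of_evalAt_ne_zero hb) (ne_zero_of_evalAt_ne_zero hd)]
    simp only [map_mul, map_add]
  · rw [evalAt_add, evalAt_mul, evalAt_mul, evalAt_mul, ← div_add_div _ _ hb hd]
    exact add_pos hp hq

theorem PositiveAt.inv {f : RatFun n} (hf : PositiveAt f X) : PositiveAt f⁻¹ X := by
  obtain ⟨a, b, hb, rfl, hp⟩ := hf
  refine ⟨b, a, ?_, by rw [inv_div], ?_⟩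
  · intro h; simp [h] at hp
  · rw [← inv_div]; exact complex_inv_pos hp

theorem PositiveAt.div {f g : RatFun n} (hf : PositiveAt f X) (hg : PositiveAt g X) :
    PositiveAt (f / g) X := by
  rw [div_eq_mul_inv]; exact hf.mul hg.inv

theorem positiveAt_algebraMap {p : MvPolynomial (Fin n × Fin n) ℂ} :
    PositiveAt (algebraMap _ (RatFun n) p) X ↔ 0 < evalAt X p := by
  constructor
  · rintro ⟨a, b, hb, h, hp⟩
    rw [eq_div_iff (ne_zero_of_evalAt_ne_zero hb), ← map_mul] at h
    have h := IsFractionRing.injective _ _ h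
    rwa [← h, evalAt_mul, mul_div_cancel_right₀ _ hb] at hp
  · intro h
    exact ⟨p, 1, by simp [evalAt], by simp, by simpa [evalAt] using h⟩

theorem PositiveAt.one : PositiveAt (1 : RatFun n) X := by
  rw [← map_one (algebraMap (MvPolynomial (Fin n × Fin n) ℂ) (RatFun n)), positiveAt_algebraMap]
  simp [evalAt]

theorem PositiveAt.pow {f : RatFun n} (hf : PositiveAt f X) (k : ℕ) : PositiveAt (f ^ k) X := by
  induction k with
  | zero => rw [pow_zero]; exact .one
  | succ k ih => rw [pow_succ]; exact ih.mul hf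

theorem PositiveAt.prod {ι : Type*} {s : Finset ι} {f : ι → RatFun n}
    (h : ∀ i ∈ s, PositiveAt (f i) X) : PositiveAt (∏ i ∈ s, f i) X :=
  Finset.prod_induction f (PositiveAt · X) (fun _ _ => PositiveAt.mul) .one h

theorem PositiveAt.ne_zero {f : RatFun n} (hf : PositiveAt f X) : f ≠ 0 := by
  rintro rfl
  rw [← map_zero (algebraMap (MvPolynomial (Fin n × Fin n) ℂ) (RatFun n)),
    positiveAt_algebraMap] at hf
  simp [evalAt] at hf

end PositiveAt

/-! ### Positive loci of mutation-equivalent seeds -/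

namespace Seed

section

variable {I F K : Type*} [DecidableEq I] [DecidableEq F]

/-- Skew-symmetry of the mutable part is wanted only for its zero diagonal: it guarantees that x_k
does not occur on the right of its own exchange relation, after any number of mutations. -/
theorem mutateMatrix_skew {B : Matrix I (I ⊕ F) ℤ} (hB : ∀ i j, B i (.inl j) = -B j (.inl i))
    (k i j : I) : mutateMatrix B k i (.inl j) = -mutateMatrix B k j (.inl i) := by
  unfold mutateMatrix
  simp only [Matrix.of_apply, Sum.inl.injEq]
  by_cases h : i = k ∨ j = k
  · rw [if_pos h, if_pos h.symm, hB i j]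
  · rw [if_neg h, if_neg (fun h' => h h'.symm), hB i j, hB j k, hB k i, abs_neg, abs_neg]
    generalize B k (.inl j) = q
    generalize B i (.inl k) = r
    -- The numerator is even, so the integer division is exact and commutes with negation; rounding
    -- would break the skew-symmetry.
    have key : ∃ m, |q| * r + q * |r| = 2 * m := by
      rcases abs_choice q with h | h <;> rcases abs_choice r with h' | h' <;> rw [h, h']
      · exact ⟨q * r, by ring⟩
      · exact ⟨0, by ring⟩
      · exact ⟨0, by ring⟩
      · exact ⟨-(q * r), by ring⟩
    obtain ⟨m, hm⟩ := key
    have h1 : |r| * q + r * |q| = 2 * m := by rw [← hm]; ring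
    have h2 : |q| * -r + -q * |r| = 2 * -m := by linarith
    rw [h1, h2, Int.mul_ediv_cancel_left _ two_ne_zero, Int.mul_ediv_cancel_left _ two_ne_zero]
    ring

end

variable {n : ℕ} {I F : Type*} [Fintype I] [Fintype F] [DecidableEq I] [DecidableEq F]

/-- The exchange relation is symmetric in x_k and x_k': its right-hand side involves only the other
variables, so x_k is a subtraction-free expression in the mutated cluster. -/
theorem mem_positiveSet_of_mutate {s : Seed I F (RatFun n)} {k : I} (hk : s.B k (.inl k) = 0)
    {X : GL (Fin n) ℂ} (hX : X ∈ (s.mutate k).positiveSet) : X ∈ s.positiveSet := by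
  have hne : ∀ v, v ≠ Sum.inl k → PositiveAt (s.x v) (X : Matrix (Fin n) (Fin n) ℂ) := by
    intro v hv
    have := hX v
    simp only [mutate] at this
    rwa [Function.update_of_ne hv] at this
  have hnew := hX (.inl k)
  simp only [mutate] at hnew
  rw [Function.update_self] at hnew
  intro v
  by_cases hv : v = Sum.inl k
  · subst hv
    set a := (∏ i, s.x i ^ (s.B k i).toNat) + ∏ i, s.x i ^ (-s.B k i).toNat with ha
    have hpow : ∀ (e : I ⊕ F → ℕ), e (.inl k) = 0 →
        PositiveAt (∏ i, s.x i ^ e i) (X : Matrix (Fin n) (Fin n) ℂ) := by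
      intro e he
      refine PositiveAt.prod fun i _ => ?_
      by_cases hi : i = Sum.inl k
      · rw [hi, he, pow_zero]; exact .one
      · exact (hne i hi).pow _
    have hapos : PositiveAt a (X : Matrix (Fin n) (Fin n) ℂ) :=
      (hpow (fun i => (s.B k i).toNat) (by simp [hk])).add
        (hpow (fun i => (-s.B k i).toNat) (by simp [hk]))
    have hnv : s.newVariable k = a / s.x (.inl k) := rfl
    have : s.x (.inl k) = a / s.newVariable k := by
      rw [hnv, div_div_cancel₀ hapos.ne_zero]
    rw [this]
    exact hapos.div hnew
  · exact hne v hv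

theorem positiveSet_subset_of_mem_clusterStructure {s s' : Seed I F (RatFun n)}
    (hs : ∀ i j, s.B i (.inl j) = -s.B j (.inl i)) (h : s' ∈ s.clusterStructure) :
    s'.positiveSet ⊆ s.positiveSet := by
  suffices (∀ i j, s'.B i (.inl j) = -s'.B j (.inl i)) ∧ s'.positiveSet ⊆ s.positiveSet from this.2
  change Relation.ReflTransGen _ s s' at h
  induction h with
  | refl => exact ⟨hs, subset_rfl⟩
  | tail _ hstep ih =>
    obtain ⟨k, rfl⟩ := hstep
    refine ⟨fun i j => mutateMatrix_skew ih.1 k i j, fun X hX => ih.2 ?_⟩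
    exact mem_positiveSet_of_mutate (by have := ih.1 k k; omega) hX

end Seed

/-! ### The functions of the initial extended cluster -/

theorem entry_map {R S : Type*} [CommRing R] [CommRing S] (f : R →+* S) {n : ℕ}
    (A : Matrix (Fin n) (Fin n) R) (i j : ℕ) : entry (A.map f) i j = f (entry A i j) := by
  unfold entry; split_ifs <;> simp

theorem cgU_map {R S : Type*} [CommRing R] [CommRing S] (f : R →+* S) {n : ℕ}
    (A B : Matrix (Fin n) (Fin n) R) (i j : ℕ) : cgU (A.map f) (B.map f) i j = f (cgU A B i j) := by
  unfold cgU calX calY; split_ifs <;> simp [entry_map]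

theorem denseMinor_map {R S : Type*} [CommRing R] [CommRing S] (f : R →+* S) (A : ℕ → ℕ → R)
    (r c p : ℕ) : denseMinor (fun i j => f (A i j)) r c p = f (denseMinor A r c p) := by
  unfold denseMinor; rw [RingHom.map_det]; rfl

theorem CGName.fn_map {R S : Type*} [CommRing R] [CommRing S] (f : R →+* S) {n : ℕ}
    (A : Matrix (Fin n) (Fin n) R) (v : CGName) :
    v.fn (A.map f) (A.map f) = f (v.fn A A) := by
  have h1 : entry (A.map f) = fun i j => f (entry A i j) := by ext; exact entry_map ..
  have h2 : cgU (A.map f) (A.map f) = fun i j => f (cgU A A i j) := by ext; exact cgU_map ..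
  cases v <;> simp only [CGName.fn, h1, h2, denseMinor_map]

/-- The initial functions are polynomials, namely determinants in the generic entries, and
evaluation commutes with determinants. -/
theorem positiveAt_fn_genericMatrix {n : ℕ} {v : CGName} {X : Matrix (Fin n) (Fin n) ℂ} :
    PositiveAt (v.fn (genericMatrix n) (genericMatrix n)) X ↔ 0 < v.fn X X := by
  let G : Matrix (Fin n) (Fin n) (MvPolynomial (Fin n × Fin n) ℂ) :=
    Matrix.of fun i j => MvPolynomial.X (i, j)
  have h1 : genericMatrix n = G.map (algebraMap _ (RatFun n)) := rfl
  have h2 : X = G.map (MvPolynomial.eval fun ij : Fin n × Fin n => X ij.1 ij.2) := by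
    ext i j; simp [G]
  rw [h1, CGName.fn_map, positiveAt_algebraMap]
  conv_rhs => rw [h2, CGName.fn_map]
  rfl

theorem cgName_pos_of_mem_TPCG {n : ℕ} {X : GL (Fin n) ℂ} (hX : X ∈ TPCG n)
    (v : CGMutable n ⊕ Fin 3) :
    0 < (cgName n v).fn (X : Matrix (Fin n) (Fin n) ℂ) (X : Matrix (Fin n) (Fin n) ℂ) := by
  obtain ⟨s, hs, hX⟩ := hX
  have := Seed.positiveSet_subset_of_mem_clusterStructure (fun i j => ?_) hs hX v
  · exact positiveAt_fn_genericMatrix.mp this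
  · simp [cgSeed, cgB]

theorem theta_pos {n : ℕ} {X : GL (Fin n) ℂ} (hX : X ∈ TPCG n) {i : ℕ} (h1 : 1 ≤ i) (hi : i ≤ n) :
    0 < (CGName.theta i).fn (X : Matrix (Fin n) (Fin n) ℂ) (X : Matrix (Fin n) (Fin n) ℂ) := by
  rcases hi.eq_or_lt with rfl | hlt
  · exact cgName_pos_of_mem_TPCG hX (.inr 0)
  · have := cgName_pos_of_mem_TPCG hX (.inl (.inl ⟨i - 1, by omega⟩))
    simpa only [cgName, Nat.sub_add_cancel h1] using this

theorem phi_pos {n : ℕ} {X : GL (Fin n) ℂ} (hX : X ∈ TPCG n) {i : ℕ} (h1 : 1 ≤ i)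
    (hi : i ≤ cgN n) :
    0 < (CGName.phi i).fn (X : Matrix (Fin n) (Fin n) ℂ) (X : Matrix (Fin n) (Fin n) ℂ) := by
  rcases hi.eq_or_lt with rfl | hlt
  · exact cgName_pos_of_mem_TPCG hX (.inr 1)
  · have := cgName_pos_of_mem_TPCG hX (.inl (.inr (.inl ⟨i - 1, by omega⟩)))
    simpa only [cgName, Nat.sub_add_cancel h1] using this

theorem psi_pos {n : ℕ} {X : GL (Fin n) ℂ} (hX : X ∈ TPCG n) {i : ℕ} (h1 : 1 ≤ i)
    (hi : i ≤ cgM n) :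
    0 < (CGName.psi i).fn (X : Matrix (Fin n) (Fin n) ℂ) (X : Matrix (Fin n) (Fin n) ℂ) := by
  rcases hi.eq_or_lt with rfl | hlt
  · exact cgName_pos_of_mem_TPCG hX (.inr 2)
  · have := cgName_pos_of_mem_TPCG hX (.inl (.inr (.inr ⟨i - 1, by omega⟩)))
    simpa only [cgName, Nat.sub_add_cancel h1] using this

/-! ### Determinantal identities -/

section Identities

variable {K : Type*} [CommRing K]

/-- Moving the `i`-th row of a determinant to the top. -/
theorem det_eq_neg_one_pow_mul_det_cons {k : ℕ} (M : Matrix (Fin (k + 1)) (Fin (k + 1)) K)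
    (i : Fin (k + 1)) :
    M.det = (-1) ^ (i : ℕ) *
      (Matrix.of (Fin.cons (M i) fun a => M (i.succAbove a)) :
        Matrix (Fin (k + 1)) (Fin (k + 1)) K).det := by
  rw [Matrix.det_succ_row M i, Matrix.det_succ_row_zero, Finset.mul_sum]
  refine Finset.sum_congr rfl fun j _ => ?_
  rw [pow_add]
  have : M.submatrix i.succAbove j.succAbove = (Matrix.of (Fin.cons (M i) fun a =>
      M (i.succAbove a)) : Matrix (Fin (k + 1)) (Fin (k + 1)) K).submatrix Fin.succ j.succAbove := by
    ext a b; simp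
  rw [this]
  simp only [Matrix.of_apply, Fin.cons_zero]
  ring

/-- Cramer's relation between `k + 1` vectors of length `k`. -/
theorem sum_mul_det_succAbove_eq_zero [IsDomain K] {k : ℕ} (d : Fin (k + 1) → Fin k → K)
    (f : (Fin k → K) → K) (hf : ∃ c : Fin k → K, ∀ v, f v = ∑ j, v j * c j) :
    ∑ i : Fin (k + 1), (-1) ^ (i : ℕ) * f (d i) *
      (Matrix.of fun a => d (i.succAbove a)).det = 0 := by
  obtain ⟨c, hc⟩ := hf
  let T : Matrix (Fin (k + 1)) (Fin (k + 1)) K := Matrix.of fun i => Fin.cons (f (d i)) (d i)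
  have h0 : T.det = 0 := by
    -- The first column of `T` is the combination of the others with coefficients `c`, so (-1, c)
    -- lies in the kernel.
    refine Matrix.exists_mulVec_eq_zero_iff.mp ⟨Fin.cons (-1) c, fun h => ?_, ?_⟩
    · simpa using congrFun h 0
    · ext i
      simp [T, Matrix.mulVec, dotProduct, Fin.sum_univ_succ, hc]
  rw [Matrix.det_succ_column_zero] at h0
  rw [← h0]
  refine Finset.sum_congr rfl fun i _ => ?_
  congr 1

/-- The truncated determinant is a linear functional of its top row; the coefficient of the
discarded last coordinate is 0. This supplies the functional for Cramer's relation in both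
identities below. -/
theorem exists_det_cons_eq_sum {m : ℕ} (S : Fin m → Fin (m + 1) → K) :
    ∃ c : Fin (m + 2) → K, ∀ v : Fin (m + 2) → K,
      (Matrix.of (Fin.cons (fun j : Fin (m + 1) => v j.castSucc) S) :
        Matrix (Fin (m + 1)) (Fin (m + 1)) K).det = ∑ j, v j * c j := by
  refine ⟨Fin.snoc (α := fun _ => K) (fun j => (-1) ^ (j : ℕ) *
    (Matrix.of fun a b => S a (j.succAbove b)).det) 0, fun v => ?_⟩
  conv_rhs => rw [Fin.sum_univ_castSucc, Fin.snoc_last, mul_zero, add_zero]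
  rw [Matrix.det_succ_row_zero]
  simp_rw [Fin.snoc_castSucc]
  refine Finset.sum_congr rfl fun j _ => ?_
  have h0 : (Matrix.of (Fin.cons (fun j : Fin (m + 1) => v j.castSucc) S) :
      Matrix (Fin (m + 1)) (Fin (m + 1)) K) 0 j = v j.castSucc := rfl
  rw [h0]
  have : (Matrix.of (Fin.cons (fun j : Fin (m + 1) => v j.castSucc) S) :
      Matrix (Fin (m + 1)) (Fin (m + 1)) K).submatrix Fin.succ j.succAbove =
      Matrix.of fun a b => S a (j.succAbove b) := by
    ext a b; simp
  rw [this]; ring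

theorem det_of_row_zero_eq_single {k : ℕ} (M : Matrix (Fin (k + 1)) (Fin (k + 1)) K)
    (h : M 0 = Pi.single 0 1) : M.det = (M.submatrix Fin.succ Fin.succ).det := by
  rw [Matrix.det_succ_row_zero, Finset.sum_eq_single 0]
  · simp [h, Fin.succAbove_zero]
  · intro j _ hj; simp [h, hj]
  · simp

/-- The Desnanot–Jacobi identity. -/
theorem det_mul_det_inner [IsDomain K] {m : ℕ} (M : Matrix (Fin (m + 2)) (Fin (m + 2)) K) :
    M.det * (M.submatrix (fun i : Fin m => i.castSucc.succ) fun i => i.castSucc.succ).det =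
      (M.submatrix Fin.castSucc Fin.castSucc).det * (M.submatrix Fin.succ Fin.succ).det -
      (M.submatrix Fin.castSucc Fin.succ).det * (M.submatrix Fin.succ Fin.castSucc).det := by
  let S : Fin m → Fin (m + 1) → K := fun i j => M i.castSucc.succ j.castSucc
  let f : (Fin (m + 2) → K) → K := fun v =>
    (Matrix.of (Fin.cons (fun j : Fin (m + 1) => v j.castSucc) S) :
        Matrix (Fin (m + 1)) (Fin (m + 1)) K).det
  -- Cramer's relation is applied to this unit vector together with the rows of `M`. The functional
  -- `f` vanishes on the inner rows, so only three terms survive, and deleting a row other than `e`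
  -- also deletes the first column.
  let e : Fin (m + 2) → K := Pi.single 0 1
  let d : Fin (m + 3) → Fin (m + 2) → K := Fin.cons e fun i => M i
  have hd : ∀ i, d (Fin.succ i) = M i := fun _ => rfl
  have key := sum_mul_det_succAbove_eq_zero d f (exists_det_cons_eq_sum S)
  rw [Fin.sum_univ_succ, Fin.sum_univ_succ, Fin.sum_univ_castSucc, Finset.sum_eq_zero] at key
  rotate_left
  · intro i _
    have : f (M i.castSucc.succ) = 0 := by
      refine Matrix.det_zero_of_row_eq (i := 0) (j := i.succ) (Fin.succ_ne_zero i).symm ?_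
      ext j; simp [S]
    rw [hd, this]; ring
  have h1 : f e = (M.submatrix (fun i : Fin m => i.castSucc.succ) fun i => i.castSucc.succ).det := by
    simp only [f]
    rw [det_of_row_zero_eq_single]
    · congr 1
    · ext j
      refine Fin.cases ?_ (fun j => ?_) j <;> simp [e]
  have h2 : f (M 0) = (M.submatrix Fin.castSucc Fin.castSucc).det := by
    simp only [f]
    congr 1; ext i j
    refine Fin.cases rfl (fun i => rfl) i
  have h3 : (M.submatrix Fin.succ Fin.castSucc).det = (-1) ^ m * f (M (Fin.last (m + 1))) := by
    rw [det_eq_neg_one_pow_mul_det_cons _ (Fin.last m)]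
    simp only [f, Fin.val_last]
    congr 2; ext i j
    refine Fin.cases rfl (fun i => ?_) i
    simp [S]
  have h4 : (Matrix.of fun a => d ((0 : Fin (m + 3)).succAbove a)).det = M.det := rfl
  have h5 : (Matrix.of fun a => d ((Fin.succ 0 : Fin (m + 3)).succAbove a)).det =
      (M.submatrix Fin.succ Fin.succ).det := by
    rw [det_of_row_zero_eq_single]
    · congr 1
    · change d ((Fin.succ 0 : Fin (m + 3)).succAbove 0) = e
      simp [d]
  have h6 : (Matrix.of fun a => d ((Fin.last m).succ.succ.succAbove a)).det =
      (M.submatrix Fin.castSucc Fin.succ).det := by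
    rw [det_of_row_zero_eq_single]
    · congr 1; ext i j
      change d ((Fin.last m).succ.succ.succAbove i.succ) j.succ = M i.castSucc j.succ
      rw [Fin.succ_succAbove_succ, hd]
      simp
    · change d ((Fin.last m).succ.succ.succAbove 0) = e
      simp [d]
  rw [h4, h5, h6, hd, hd, h2, Fin.succ_last] at key
  change _ * f e * _ + _ = _ at key
  rw [h1] at key
  rw [h3]
  simp only [Fin.val_zero, Fin.val_succ, Fin.val_last, pow_zero, zero_add, pow_succ] at key
  linear_combination key

/-- The three-term relation between the maximal and the almost maximal minors of a
`(m + 3) × (m + 2)` matrix. -/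
theorem det_drop_mul_det_inner [IsDomain K] {m : ℕ} (d : Fin (m + 3) → Fin (m + 2) → K)
    (q : Fin (m + 1)) :
    (Matrix.of fun a => d (q.castSucc.succ.succAbove a)).det *
      (Matrix.of fun (a b : Fin (m + 1)) => d a.castSucc.succ b.castSucc).det =
    (Matrix.of fun (a b : Fin (m + 1)) => d (q.succ.succAbove a).castSucc b.castSucc).det *
      (Matrix.of fun a => d a.succ).det +
    (Matrix.of fun (a b : Fin (m + 1)) => d (q.castSucc.succAbove a).succ b.castSucc).det *
      (Matrix.of fun a => d a.castSucc).det := by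
  -- `S` consists of the inner vectors without the one to be dropped, so `f` kills every inner
  -- vector except that one and Cramer's relation has three terms.
  let S : Fin m → Fin (m + 1) → K := fun i j => d (q.succAbove i).castSucc.succ j.castSucc
  let f : (Fin (m + 2) → K) → K := fun v =>
    (Matrix.of (Fin.cons (fun j : Fin (m + 1) => v j.castSucc) S) :
        Matrix (Fin (m + 1)) (Fin (m + 1)) K).det
  have key := sum_mul_det_succAbove_eq_zero d f (exists_det_cons_eq_sum S)
  rw [Fin.sum_univ_succ, Fin.sum_univ_castSucc, Finset.sum_eq_single q] at key
  rotate_left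
  · intro i _ hi
    obtain ⟨i, rfl⟩ := Fin.exists_succAbove_eq hi
    have : f (d (q.succAbove i).castSucc.succ) = 0 := by
      refine Matrix.det_zero_of_row_eq (i := 0) (j := i.succ) (Fin.succ_ne_zero i).symm ?_
      ext j; simp [S]
    rw [this]; ring
  · simp
  have h1 : f (d 0) =
      (Matrix.of fun (a b : Fin (m + 1)) => d (q.succ.succAbove a).castSucc b.castSucc).det := by
    simp only [f]
    congr 1; ext i j
    refine Fin.cases ?_ (fun i => ?_) i
    · simp
    · simp [S]
  have h2 : (Matrix.of fun (a b : Fin (m + 1)) => d a.castSucc.succ b.castSucc).det =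
      (-1) ^ (q : ℕ) * f (d q.castSucc.succ) := by
    rw [det_eq_neg_one_pow_mul_det_cons _ q]
    simp only [f]
    congr 2
  have h3 : (Matrix.of fun (a b : Fin (m + 1)) => d (q.castSucc.succAbove a).succ b.castSucc).det =
      (-1) ^ m * f (d (Fin.last m).succ.succ) := by
    rw [det_eq_neg_one_pow_mul_det_cons _ (Fin.last m)]
    simp only [f, Fin.val_last]
    congr 2; ext i j
    refine Fin.cases ?_ (fun i => ?_) i
    · simp
    · simp [S]
  have h4 : (Matrix.of fun a => d ((0 : Fin (m + 3)).succAbove a)).det =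
      (Matrix.of fun a => d a.succ).det := by
    simp 
  have h5 : (Matrix.of fun a => d ((Fin.last (m + 1)).succ.succAbove a)).det =
      (Matrix.of fun a => d a.castSucc).det := by
    simp 
  rw [h4, h5, h1] at key
  rw [h2, h3]
  simp only [Fin.val_zero, Fin.val_succ, Fin.val_last, Fin.val_castSucc, pow_zero,
    pow_succ, Fin.succ_last] at key ⊢
  linear_combination -key

end Identities

/-! ### Criteria for total positivity -/

theorem denseMinor_mul_inner {K : Type*} [CommRing K] [IsDomain K] (A : ℕ → ℕ → K) (r c p : ℕ) :
    denseMinor A r c (p + 2) * denseMinor A (r + 1) (c + 1) p =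
      denseMinor A r c (p + 1) * denseMinor A (r + 1) (c + 1) (p + 1) -
      denseMinor A r (c + 1) (p + 1) * denseMinor A (r + 1) c (p + 1) := by
  have := det_mul_det_inner (Matrix.of fun s t : Fin (p + 2) => A (r + s) (c + t))
  unfold denseMinor
  have e : ∀ (q k : ℕ) (s : Fin q), k + ((s : ℕ) + 1) = k + 1 + s := by intros; omega
  simp only [Matrix.submatrix, Matrix.of_apply, Fin.val_succ, Fin.val_castSucc, e] at this
  exact this

/-- All solid minors are positive as soon as those are that contain the first row or the first
column. -/
theorem denseMinor_pos_of_initial {A : ℕ → ℕ → ℂ} {n : ℕ}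
    (hrow : ∀ c p, c + p ≤ n → 0 < denseMinor A 0 c p)
    (hcol : ∀ r p, r + p ≤ n → 0 < denseMinor A r 0 p) :
    ∀ r c p, r + p ≤ n → c + p ≤ n → 0 < denseMinor A r c p := by
  intro r
  induction r with
  | zero => exact fun c p _ hc => hrow c p hc
  | succ r ihr =>
    intro c
    induction c with
    | zero => exact fun p hr _ => hcol _ p hr
    | succ c ihc =>
      intro p
      induction p with
      | zero => intros; simp [denseMinor]
      | succ p ihp =>
        intro hr hc
        -- Desnanot–Jacobi, solved for the minor at the lower right, is subtraction-free in minors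
        -- that are positive by the three inductions.
        have key := denseMinor_mul_inner A r c p
        have h1 := ihr c (p + 2) (by omega) (by omega)
        have h2 := ihp (by omega) (by omega)
        have h3 := ihr c (p + 1) (by omega) (by omega)
        have h4 := ihr (c + 1) (p + 1) (by omega) (by omega)
        have h5 := ihc (p + 1) (by omega) (by omega)
        refine complex_pos_of_mul_pos ?_ h3
        have : denseMinor A (r + 1) (c + 1) (p + 1) * denseMinor A r c (p + 1) =
            denseMinor A r c (p + 2) * denseMinor A (r + 1) (c + 1) p +
            denseMinor A r (c + 1) (p + 1) * denseMinor A (r + 1) c (p + 1) := by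
          linear_combination -key
        rw [this]
        exact add_pos (mul_pos h1 h2) (mul_pos h4 h5)

/-- Nonconsecutive indices leave a gap. Filling it with one index, without moving the two ends,
gives the m + 3 vectors for `det_drop_mul_det_inner`. -/
theorem exists_strictMono_succAbove {m : ℕ} {c : Fin (m + 2) → ℕ} (hc : StrictMono c)
    (hgap : c 0 + (m + 1) ≠ c (Fin.last _)) :
    ∃ (d : Fin (m + 3) → ℕ) (q : Fin (m + 1)), StrictMono d ∧ d 0 = c 0 ∧
      d (Fin.last _) = c (Fin.last _) ∧ ∀ a, d (q.castSucc.succ.succAbove a) = c a := by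
  obtain ⟨q, hq⟩ : ∃ q : Fin (m + 1), c q.castSucc + 1 < c q.succ := by
    by_contra! h
    apply hgap
    have : ∀ i (hi : i < m + 2), c ⟨i, hi⟩ = c 0 + i := by
      intro i
      induction i with
      | zero => intro _; rfl
      | succ i ih =>
        intro hi
        have h1 := ih (by omega)
        have h2 := h ⟨i, by omega⟩
        have h3 := hc (a := ⟨i, by omega⟩) (b := ⟨i + 1, hi⟩) (by simp)
        simp only [Fin.castSucc_mk, Fin.succ_mk] at h2
        omega
    exact (this (m + 1) (by omega)).symm
  refine ⟨fun i => if h : (i : ℕ) ≤ q then c ⟨i, by omega⟩ else if (i : ℕ) = q + 1 then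
    c q.castSucc + 1 else c ⟨i - 1, by omega⟩, q, ?_, ?_, ?_, ?_⟩
  · intro i j hij
    have hij : (i : ℕ) < j := hij
    have hm : ∀ a b : Fin (m + 2), (a : ℕ) ≤ b → c a ≤ c b := fun a b h => hc.monotone h
    have hs : ∀ a b : Fin (m + 2), (a : ℕ) < b → c a < c b := fun a b h => hc h
    dsimp only
    split_ifs with h1 h2 h3 h4 h5
    · exact hs _ _ hij
    · exact Nat.lt_succ_of_le (hm _ _ (by simpa using h1))
    · exact hs _ _ (by simp; omega)
    · omega
    · omega
    · exact hq.trans_le (hm _ _ (by simp; omega))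
    · omega
    · omega
    · exact hs _ _ (by simp; omega)
  · simp
  · have h1 : ¬ (Fin.last (m + 2) : ℕ) ≤ q := by simp; omega
    have h2 : ¬ (Fin.last (m + 2) : ℕ) = q + 1 := by simp; omega
    simp only [h1, h2, dite_false, if_false]
    rfl
  · intro a
    by_cases ha : (a : ℕ) ≤ q
    · have : q.castSucc.succ.succAbove a = a.castSucc :=
        Fin.succAbove_of_castSucc_lt _ _ (by simp [Fin.lt_def]; omega)
      simp [this, ha]
    · have : q.castSucc.succ.succAbove a = a.succ :=
        Fin.succAbove_of_le_castSucc _ _ (by simp [Fin.le_def]; omega)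
      have h1 : ¬ (a : ℕ) + 1 ≤ q := by omega
      have h2 : ¬ (a : ℕ) = q := by omega
      simp [this, h1, h2]

/-- If all solid minors are positive, so are the minors with consecutive rows. -/
theorem det_pos_of_denseMinor_pos_of_consecutive_rows {A : ℕ → ℕ → ℂ} {a b : ℕ}
    (h : ∀ r c p, r + p ≤ a → c + p ≤ b → 0 < denseMinor A r c p) :
    ∀ (p w r : ℕ) (c : Fin p → ℕ), StrictMono c → (∀ i, c i < b) → r + p ≤ a →
      (∀ i j, c i ≤ c j + w) → 0 < (Matrix.of fun t s : Fin p => A (r + s) (c t)).det := by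
  intro p
  induction p with
  | zero => intros; simp
  | succ p ihp =>
    cases p with
    | zero =>
      intro w r c hc hb hr _
      have := h r (c 0) 1 (by omega) (hb 0)
      simpa [denseMinor] using this
    | succ m =>
      intro w
      induction w with
      | zero =>
        intro r c hc hb hr hw
        have h1 := hw 1 0
        have h2 := hc (a := 0) (b := 1) (by simp)
        omega
      | succ w ihw =>
        intro r c hc hb hr hw
        by_cases hgap : c 0 + (m + 1) = c (Fin.last _)
        · have hval : ∀ t, c t = c 0 + t := by
            have h1 : ∀ i (hi : i < m + 2), c 0 + i ≤ c ⟨i, hi⟩ := by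
              intro i
              induction i with
              | zero => intro _; rfl
              | succ i ih =>
                intro hi
                have h3 := hc (a := ⟨i, by omega⟩) (b := ⟨i + 1, hi⟩) (by simp)
                have := ih (by omega)
                omega
            have h2 : ∀ k i (hi : i < m + 2), i + k = m + 1 → c ⟨i, hi⟩ + k ≤ c 0 + (m + 1) := by
              intro k
              induction k with
              | zero =>
                intro i hi hk
                obtain rfl : i = m + 1 := by omega
                exact hgap.ge
              | succ k ih =>
                intro i hi hk
                have := ih (i + 1) (by omega) (by omega)
                have h3 := hc (a := ⟨i, hi⟩) (b := ⟨i + 1, by omega⟩) (by simp)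
                omega
            intro t
            have e1 := h1 t t.2
            have e2 := h2 (m + 1 - t) t t.2 (by omega)
            simp only [Fin.eta] at e1 e2
            omega
          have := h r (c 0) (m + 2) (by omega) (by have := hb (Fin.last _); omega)
          rw [denseMinor, ← Matrix.det_transpose] at this
          convert this using 1
          congr 1; ext t s
          simp [hval t]
        -- In the three-term relation for the enlarged set, the other two large minors omit an end
        -- and hence have smaller spread, while the remaining factors have smaller size.
        · obtain ⟨d, q, hd, hd0, hdl, hdq⟩ := exists_strictMono_succAbove hc hgap
          have hdb : ∀ i, d i < b := fun i => by
            have := hd.monotone (Fin.le_last i)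
            have := hb (Fin.last _)
            omega
          have hbig : ∀ e : Fin (m + 1) → Fin (m + 3), StrictMono e →
              0 < (Matrix.of fun t s : Fin (m + 1) => A (r + s) (d (e t))).det := fun e he =>
            ihp b r (d ∘ e) (hd.comp he) (fun i => hdb _) (by omega) (fun i j => by
              have := hdb (e i); simp only [Function.comp]; omega)
          have key := det_drop_mul_det_inner (fun i (s : Fin (m + 2)) => A (r + s) (d i)) q
          simp only [hdq] at key
          have hlast : ∀ i, d i ≤ c (Fin.last _) := fun i => hdl ▸ hd.monotone (Fin.le_last i)
          have hfirst : ∀ i, c 0 ≤ d i := fun i => hd0 ▸ hd.monotone (Fin.zero_le i)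
          have hw' := hw (Fin.last _) 0
          have p1 : 0 < (Matrix.of fun t s : Fin (m + 2) => A (r + s) (d t.succ)).det := by
            refine ihw r (d ∘ Fin.succ) (hd.comp (Fin.strictMono_succ)) (fun i => hdb _) hr ?_
            intro i j
            have h1 := hlast i.succ
            have h2 := hd (Fin.succ_pos j)
            simp only [Function.comp]; omega
          have p2 : 0 < (Matrix.of fun t s : Fin (m + 2) => A (r + s) (d t.castSucc)).det := by
            refine ihw r (d ∘ Fin.castSucc) (hd.comp (Fin.strictMono_castSucc)) (fun i => hdb _)
              hr ?_
            intro i j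
            have h1 := hfirst j.castSucc
            have h2 : d i.castSucc < c (Fin.last _) := hdl ▸ hd (Fin.castSucc_lt_last i)
            simp only [Function.comp]; omega
          refine complex_pos_of_mul_pos ?_ (hbig (fun t => t.castSucc.succ)
            (Fin.strictMono_succ.comp Fin.strictMono_castSucc))
          have e1 := hbig (fun t => (q.succ.succAbove t).castSucc)
            (Fin.strictMono_castSucc.comp (Fin.strictMono_succAbove _))
          have e2 := hbig (fun t => (q.castSucc.succAbove t).succ)
            (Fin.strictMono_succ.comp (Fin.strictMono_succAbove _))
          simp only [Fin.val_castSucc] at key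
          rw [key]
          exact add_pos (mul_pos e1 p1) (mul_pos e2 p2)

/-- Fekete's criterion: if all solid minors are positive, so are all minors. -/
theorem det_pos_of_denseMinor_pos {A : ℕ → ℕ → ℂ} {a b : ℕ}
    (h : ∀ r c p, r + p ≤ a → c + p ≤ b → 0 < denseMinor A r c p) {k : ℕ} {r c : Fin k → ℕ}
    (hr : StrictMono r) (hc : StrictMono c) (hra : ∀ i, r i < a) (hcb : ∀ i, c i < b) :
    0 < (Matrix.of fun s t : Fin k => A (r s) (c t)).det := by
  let c' : ℕ → ℕ := fun i => if hi : i < k then c ⟨i, hi⟩ else 0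
  -- The consecutive case is used twice: here with the roles of rows and columns exchanged and the
  -- selected columns renumbered consecutively, and below for the solid minors of that matrix.
  have key := det_pos_of_denseMinor_pos_of_consecutive_rows (A := fun i j => A j (c' i))
    (a := k) (b := a) ?_ k a 0 r hr hra (by omega) (fun i j => by have := hra i; omega)
  · convert key using 4 with s t
    simp [c']
  · intro i j p hi hj
    have := det_pos_of_denseMinor_pos_of_consecutive_rows h p b j
      (fun s => c ⟨i + s, by omega⟩) (fun s t hst => hc (by simpa using hst))
      (fun s => hcb _) hj (fun s t => by have := hcb ⟨i + s, by omega⟩; omega)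
    convert this using 1
    unfold denseMinor
    congr 1; ext s t
    have : i + (s : ℕ) < k := by omega
    simp [c', this]

/-! ### Totally positive matrices and elementary operations -/

/-- All minors of `M` are positive. -/
def IsTP {n : ℕ} (M : Matrix (Fin n) (Fin n) ℂ) : Prop :=
  ∀ (m : ℕ) (r c : Fin m → Fin n), StrictMono r → StrictMono c → 0 < (M.submatrix r c).det

theorem IsTP.transpose {n : ℕ} {M : Matrix (Fin n) (Fin n) ℂ} (h : IsTP M) : IsTP M.transpose := by
  intro m r c hr hc
  have := h m c r hc hr
  rwa [← Matrix.det_transpose] at this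

/-- Adding a nonnegative multiple of a row to the preceding row preserves total positivity. -/
theorem IsTP.add_smul_next_row {n : ℕ} {M M' : Matrix (Fin n) (Fin n) ℂ} (h : IsTP M)
    {k l : Fin n} (hkl : (l : ℕ) = k + 1) {t : ℂ} (ht : 0 ≤ t)
    (hk : ∀ b, M' k b = M k b + t * M l b) (hne : ∀ a b, a ≠ k → M' a b = M a b) : IsTP M' := by
  intro m r c hr hc
  by_cases hks : ∃ s, r s = k
  · obtain ⟨s, rfl⟩ := hks
    have hM' : ∀ r' : Fin m → Fin n, M'.submatrix r c = (M.submatrix r c).updateRow s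
        ((M.submatrix r c) s + t • fun b => M l (c b)) := by
      intro _
      ext a b
      by_cases ha : a = s
      · subst ha; simp [hk]
      · rw [Matrix.updateRow_ne ha]
        exact hne _ _ (fun e => ha (hr.injective e))
    rw [hM' r]
    by_cases hls : ∃ s', r s' = l
    · obtain ⟨s', rfl⟩ := hls
      have hss : s ≠ s' := by rintro rfl; omega
      have := Matrix.det_updateRow_add_smul_self (M.submatrix r c) hss t
      have e : (M.submatrix r c) s' = fun b => M (r s') (c b) := rfl
      rw [← e, this]
      exact h m r c hr hc
    · push Not at hls
      rw [Matrix.det_updateRow_add, Matrix.det_updateRow_smul, Matrix.updateRow_eq_self]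
      -- Since `l` immediately follows `k` and is not among the selected rows, replacing `k` by `l`
      -- keeps the rows in increasing order.
      have hr' : StrictMono (Function.update r s l) := by
        intro a b hab
        have h1 := hr hab
        rcases eq_or_ne a s with rfl | ha
        · rw [Function.update_self, Function.update_of_ne hab.ne']
          have := hls b
          rw [Fin.lt_def] at h1 ⊢
          rw [Ne, Fin.ext_iff] at this
          omega
        · rw [Function.update_of_ne ha]
          rcases eq_or_ne b s with rfl | hb
          · rw [Function.update_self]
            rw [Fin.lt_def] at h1 ⊢
            omega
          · rwa [Function.update_of_ne hb]
      have e : (M.submatrix r c).updateRow s (fun b => M l (c b)) =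
          M.submatrix (Function.update r s l) c := by
        ext a b
        by_cases ha : a = s
        · subst ha; simp
        · simp [Matrix.updateRow_ne ha, Function.update_of_ne ha]
      rw [e]
      exact add_pos_of_pos_of_nonneg (h m r c hr hc) (mul_nonneg ht (h m _ c hr' hc).le)
  · push Not at hks
    have : M'.submatrix r c = M.submatrix r c := by
      ext a b; exact hne _ _ (hks a)
    rw [this]
    exact h m r c hr hc

/-- The monoid generated by the elementary matrices `1 + t E_{s+1,s}` with `t ≥ 0`. -/
def elemMonoid (n : ℕ) : Submonoid (Matrix (Fin n) (Fin n) ℂ) :=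
  Submonoid.closure {M | ∃ (i j : Fin n) (t : ℂ), (i : ℕ) = j + 1 ∧ 0 ≤ t ∧
    M = Matrix.transvection i j t}

theorem transvection_mem_elemMonoid {n : ℕ} {i j : Fin n} {t : ℂ} (h : (i : ℕ) = j + 1)
    (ht : 0 ≤ t) : Matrix.transvection i j t ∈ elemMonoid n :=
  Submonoid.subset_closure ⟨i, j, t, h, ht, rfl⟩

/-- Total positivity after the order of the rows is reversed. -/
def IsRevTP {n : ℕ} (M : Matrix (Fin n) (Fin n) ℂ) : Prop := IsTP (M.submatrix Fin.rev id)

/-- A lower elementary factor adds a multiple of a row to the following one; in reversed order that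
is the preceding one. -/
theorem IsRevTP.elem_mul {n : ℕ} {G M : Matrix (Fin n) (Fin n) ℂ} (hG : G ∈ elemMonoid n)
    (hM : IsRevTP M) : IsRevTP (G * M) := by
  revert M
  refine Submonoid.closure_induction
    (motive := fun G _ => ∀ {M : Matrix (Fin n) (Fin n) ℂ}, IsRevTP M → IsRevTP (G * M))
    ?_ ?_ ?_ hG
  · rintro _ ⟨i, j, t, hij, ht, rfl⟩ M hM
    refine IsTP.add_smul_next_row hM (k := i.rev) (l := j.rev) ?_ ht ?_ ?_
    · simp only [Fin.val_rev]; omega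
    · intro b; simp
    · intro a b ha
      rw [Matrix.submatrix_apply, Matrix.transvection_mul_apply_of_ne]
      · rfl
      · rintro rfl; simp at ha
  · intro M hM; rwa [one_mul]
  · intro x y _ _ hx hy M hM
    rw [mul_assoc]; exact hx (hy hM)

theorem IsRevTP.mul_elem {n : ℕ} {G M : Matrix (Fin n) (Fin n) ℂ} (hG : G ∈ elemMonoid n)
    (hM : IsRevTP M) : IsRevTP (M * G) := by
  revert M
  refine Submonoid.closure_induction
    (motive := fun G _ => ∀ {M : Matrix (Fin n) (Fin n) ℂ}, IsRevTP M → IsRevTP (M * G))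
    ?_ ?_ ?_ hG
  · rintro _ ⟨i, j, t, hij, ht, rfl⟩ M hM
    refine IsTP.transpose (M := ((M * Matrix.transvection i j t).submatrix Fin.rev id).transpose) ?_
    refine IsTP.add_smul_next_row hM.transpose (k := j) (l := i) hij ht ?_ ?_
    · intro b; simp
    · intro a b ha
      simp [ha]
  · intro M hM; rwa [mul_one]
  · intro x y _ _ hx hy M hM
    rw [← mul_assoc]; exact hy (hx hM)

/-! ### Unitriangular matrices -/

/-- Lower triangular matrices with ones on the diagonal. -/
def IsLowerUni {n : ℕ} (M : Matrix (Fin n) (Fin n) ℂ) : Prop :=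
  (∀ i, M i i = 1) ∧ ∀ i j, i < j → M i j = 0

namespace IsLowerUni

variable {n : ℕ} {M N : Matrix (Fin n) (Fin n) ℂ}

theorem one : IsLowerUni (1 : Matrix (Fin n) (Fin n) ℂ) :=
  ⟨by simp, fun _ _ h => Matrix.one_apply_ne h.ne⟩

theorem mul (hM : IsLowerUni M) (hN : IsLowerUni N) : IsLowerUni (M * N) := by
  constructor
  · intro i
    rw [Matrix.mul_apply, Finset.sum_eq_single i, hM.1, hN.1, one_mul]
    · intro j _ hj
      rcases hj.lt_or_gt with h | h
      · rw [hN.2 _ _ h, mul_zero]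
      · rw [hM.2 _ _ h, zero_mul]
    · simp
  · intro i j hij
    rw [Matrix.mul_apply]
    refine Finset.sum_eq_zero fun k _ => ?_
    rcases lt_or_ge i k with h | h
    · rw [hM.2 _ _ h, zero_mul]
    · rw [hN.2 _ _ (h.trans_lt hij), mul_zero]

theorem det_eq_one (hM : IsLowerUni M) : M.det = 1 := by
  rw [Matrix.det_of_isLowerTriangular M fun i j h => hM.2 i j h]
  simp [hM.1]

theorem exists_inv (hM : IsLowerUni M) : ∃ P, IsLowerUni P ∧ P * M = 1 ∧ M * P = 1 := by
  have hu : IsUnit M.det := by rw [hM.det_eq_one]; exact isUnit_one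
  let _ := Matrix.invertibleOfIsUnitDet M hu
  have hbt : Matrix.BlockTriangular M OrderDual.toDual := fun i j h => hM.2 i j h
  have hlow : ∀ i j, i < j → M⁻¹ i j = 0 := fun i j h =>
    Matrix.blockTriangular_inv_of_blockTriangular hbt h
  refine ⟨M⁻¹, ⟨fun i => ?_, hlow⟩, Matrix.nonsing_inv_mul M hu, Matrix.mul_nonsing_inv M hu⟩
  have := congrFun (congrFun (Matrix.mul_nonsing_inv M hu) i) i
  rw [Matrix.mul_apply, Finset.sum_eq_single i, hM.1, one_mul, Matrix.one_apply_eq] at this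
  · exact this
  · intro j _ hj
    rcases hj.lt_or_gt with h | h
    · rw [hlow _ _ h, mul_zero]
    · rw [hM.2 _ _ h, zero_mul]
  · simp

end IsLowerUni

theorem isLowerUni_of_mem_elemMonoid {n : ℕ} {G : Matrix (Fin n) (Fin n) ℂ}
    (hG : G ∈ elemMonoid n) : IsLowerUni G := by
  refine Submonoid.closure_induction ?_ .one (fun x y _ _ => IsLowerUni.mul) hG
  rintro _ ⟨i, j, t, hij, ht, rfl⟩
  constructor
  · intro a
    have : ¬ (i = a ∧ j = a) := by rintro ⟨rfl, rfl⟩; omega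
    simp [Matrix.transvection, this]
  · intro a b hab
    have : ¬ (i = a ∧ j = b) := by rintro ⟨rfl, rfl⟩; rw [Fin.lt_def] at hab; omega
    simp [Matrix.transvection, this, hab.ne]

/-! ### The shift of a unitriangular matrix -/

/-- The block matrix `1 ⊕ C'`, where `C'` is obtained from `C` by deletion of the last row and
column. -/
def shift {n : ℕ} (C : Matrix (Fin (n + 1)) (Fin (n + 1)) ℂ) :
    Matrix (Fin (n + 1)) (Fin (n + 1)) ℂ :=
  Matrix.of fun i j => Fin.cases (motive := fun _ => ℂ) (Fin.cases (motive := fun _ => ℂ) 1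
    (fun _ => 0) j) (fun i' => Fin.cases (motive := fun _ => ℂ) 0
    (fun j' => C i'.castSucc j'.castSucc) j) i

section shift

variable {n : ℕ} {C D : Matrix (Fin (n + 1)) (Fin (n + 1)) ℂ}

@[simp] theorem shift_zero_zero : shift C 0 0 = 1 := rfl
@[simp] theorem shift_zero_succ (j : Fin n) : shift C 0 j.succ = 0 := rfl
@[simp] theorem shift_succ_zero (i : Fin n) : shift C i.succ 0 = 0 := rfl
@[simp] theorem shift_succ_succ (i j : Fin n) :
    shift C i.succ j.succ = C i.castSucc j.castSucc := rfl

theorem IsLowerUni.shift (hC : IsLowerUni C) : IsLowerUni (shift C) := by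
  constructor
  · intro i
    refine Fin.cases rfl (fun i => ?_) i
    simp [hC.1]
  · intro i j
    refine Fin.cases ?_ (fun i => ?_) i <;> refine Fin.cases ?_ (fun j => ?_) j
    · simp
    · simp
    · simp
    · intro h
      exact hC.2 _ _ (by simpa using h)

theorem shift_one : shift (1 : Matrix (Fin (n + 1)) (Fin (n + 1)) ℂ) = 1 := by
  ext i j
  refine Fin.cases ?_ (fun i => ?_) i <;> refine Fin.cases ?_ (fun j => ?_) j
  · simp
  · rw [shift_zero_succ, Matrix.one_apply_ne (Fin.succ_ne_zero j).symm]
  · rw [shift_succ_zero, Matrix.one_apply_ne (Fin.succ_ne_zero i)]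
  · simp [Matrix.one_apply]

/-- Deleting the last row and column is multiplicative here because a lower triangular left factor
has only zeros in its last column above the corner. -/
theorem shift_mul (hC : IsLowerUni C) : shift (C * D) = shift C * shift D := by
  ext i j
  refine Fin.cases ?_ (fun i => ?_) i <;> refine Fin.cases ?_ (fun j => ?_) j
  · simp [Matrix.mul_apply, Fin.sum_univ_succ]
  · simp [Matrix.mul_apply, Fin.sum_univ_succ]
  · simp [Matrix.mul_apply, Fin.sum_univ_succ]
  · rw [shift_succ_succ, Matrix.mul_apply, Matrix.mul_apply, Fin.sum_univ_castSucc,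
      Fin.sum_univ_succ, hC.2 i.castSucc (Fin.last n) (Fin.castSucc_lt_last i)]
    simp

/-- The generator at (i, j) becomes the one at (i + 1, j + 1); the one in the last row loses its
parameter and becomes 1. -/
theorem shift_mem_elemMonoid (hC : C ∈ elemMonoid (n + 1)) : shift C ∈ elemMonoid (n + 1) := by
  refine Submonoid.closure_induction (motive := fun x _ => shift x ∈ elemMonoid (n + 1)) ?_ ?_ ?_ hC
  · rintro _ ⟨i, j, t, hij, ht, rfl⟩
    rcases Nat.lt_or_ge i n with hi | hi
    · obtain ⟨i, rfl⟩ : ∃ i' : Fin n, i'.castSucc = i := ⟨⟨i, hi⟩, rfl⟩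
      obtain ⟨j, rfl⟩ : ∃ j' : Fin n, j'.castSucc = j := ⟨⟨j, by omega⟩, rfl⟩
      have : shift (Matrix.transvection i.castSucc j.castSucc t) =
          Matrix.transvection i.succ j.succ t := by
        have h := shift_one (n := n)
        ext a b
        have hab := congrFun (congrFun h a) b
        simp only [Matrix.transvection, Matrix.add_apply, ← hab]
        refine Fin.cases ?_ (fun a => ?_) a <;> refine Fin.cases ?_ (fun b => ?_) b <;>
          simp [Matrix.single_apply]
      rw [this]
      exact transvection_mem_elemMonoid (by simpa using hij) ht
    · have : shift (Matrix.transvection i j t) = shift 1 := by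
        ext a b
        refine Fin.cases ?_ (fun a => ?_) a <;> refine Fin.cases ?_ (fun b => ?_) b
        · rfl
        · rfl
        · rfl
        · have hne : ¬ (i = a.castSucc ∧ j = b.castSucc) := by
            rintro ⟨rfl, -⟩
            simp at hi
            omega
          rw [shift_succ_succ, shift_succ_succ, Matrix.transvection, Matrix.add_apply,
            Matrix.single_apply, if_neg hne, add_zero]
      rw [this, shift_one]
      exact one_mem _
  · rw [shift_one]; exact one_mem _
  · intro x y hx _ h1 h2
    rw [shift_mul (isLowerUni_of_mem_elemMonoid hx)]
    exact mul_mem h1 h2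

theorem shift_iterate_apply (k : ℕ) (i j : Fin (n + 1)) (h : (i : ℕ) < k ∨ (j : ℕ) < k) :
    (shift^[k] C) i j = if i = j then 1 else 0 := by
  induction k generalizing i j with
  | zero => omega
  | succ k ih =>
    rw [Function.iterate_succ_apply']
    revert h
    refine Fin.cases ?_ (fun i => ?_) i <;> refine Fin.cases ?_ (fun j => ?_) j <;> intro h
    · simp
    · simp [(Fin.succ_ne_zero j).symm]
    · simp
    · rw [shift_succ_succ, ih]
      · simp
      · simpa using h

theorem shift_iterate_eq_one : shift^[n + 1] C = 1 := by
  ext i j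
  rw [shift_iterate_apply _ _ _ (Or.inl i.2), Matrix.one_apply]

theorem shift_iterate_mem_elemMonoid (hC : C ∈ elemMonoid (n + 1)) (k : ℕ) :
    shift^[k] C ∈ elemMonoid (n + 1) := by
  induction k with
  | zero => exact hC
  | succ k ih => rw [Function.iterate_succ_apply']; exact shift_mem_elemMonoid ih

theorem mem_elemMonoid_of_eq_shift_mul {N P : Matrix (Fin (n + 1)) (Fin (n + 1)) ℂ}
    (hP : IsLowerUni P) (hN : N ∈ elemMonoid (n + 1)) (h : P = shift P * N) :
    P ∈ elemMonoid (n + 1) := by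
  have hl : ∀ k, IsLowerUni (shift^[k] P) := fun k => by
    induction k with
    | zero => exact hP
    | succ k ih => rw [Function.iterate_succ_apply']; exact ih.shift
  -- Applying the shift repeatedly to the equation gives P = τⁿ⁺¹(P) τⁿ(N) ⋯ τ(N) N, and τⁿ⁺¹(P) =
  -- 1.
  have hk : ∀ k, shift^[k] P = shift^[k + 1] P * shift^[k] N := fun k => by
    induction k with
    | zero => exact h
    | succ k ih =>
      conv_lhs => rw [Function.iterate_succ_apply', ih, shift_mul (hl _)]
      rw [← Function.iterate_succ_apply' shift, ← Function.iterate_succ_apply' shift]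
  have : ∀ k l, k + l = n + 1 → shift^[l] P ∈ elemMonoid (n + 1) := by
    intro k
    induction k with
    | zero =>
      intro l hl
      obtain rfl : l = n + 1 := by omega
      rw [shift_iterate_eq_one]; exact one_mem _
    | succ k ih =>
      intro l hl
      rw [hk l]
      exact mul_mem (ih (l + 1) (by omega)) (shift_iterate_mem_elemMonoid hN l)
  exact this (n + 1) 0 rfl

theorem mem_elemMonoid_of_eq_mul_shift {N P : Matrix (Fin (n + 1)) (Fin (n + 1)) ℂ}
    (hN : N ∈ elemMonoid (n + 1)) (h : P = N * shift P) :
    P ∈ elemMonoid (n + 1) := by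
  have hk : ∀ k, shift^[k] P = shift^[k] N * shift^[k + 1] P := fun k => by
    induction k with
    | zero => exact h
    | succ k ih =>
      conv_lhs => rw [Function.iterate_succ_apply', ih,
        shift_mul (isLowerUni_of_mem_elemMonoid (shift_iterate_mem_elemMonoid hN k))]
      rw [← Function.iterate_succ_apply' shift, ← Function.iterate_succ_apply' shift]
  have : ∀ k l, k + l = n + 1 → shift^[l] P ∈ elemMonoid (n + 1) := by
    intro k
    induction k with
    | zero =>
      intro l hl
      obtain rfl : l = n + 1 := by omega
      rw [shift_iterate_eq_one]; exact one_mem _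
    | succ k ih =>
      intro l hl
      rw [hk l]
      exact mul_mem (shift_iterate_mem_elemMonoid hN l) (ih (l + 1) (by omega))
  exact this (n + 1) 0 rfl

end shift

/-! ### Reflection in the antidiagonal -/

/-- The reflection of a square matrix in its antidiagonal. -/
def antiTranspose {n : ℕ} (M : Matrix (Fin n) (Fin n) ℂ) : Matrix (Fin n) (Fin n) ℂ :=
  M.transpose.submatrix Fin.rev Fin.rev

theorem antiTranspose_mul {n : ℕ} (M N : Matrix (Fin n) (Fin n) ℂ) :
    antiTranspose (M * N) = antiTranspose N * antiTranspose M := by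
  unfold antiTranspose
  rw [Matrix.transpose_mul]
  exact (Matrix.submatrix_mul_equiv _ _ _ Fin.revPerm _).symm

theorem antiTranspose_antiTranspose {n : ℕ} (M : Matrix (Fin n) (Fin n) ℂ) :
    antiTranspose (antiTranspose M) = M := by
  ext i j; simp [antiTranspose]

theorem IsLowerUni.antiTranspose {n : ℕ} {M : Matrix (Fin n) (Fin n) ℂ} (h : IsLowerUni M) :
    IsLowerUni (antiTranspose M) :=
  ⟨fun _ => h.1 _, fun _ _ hij => h.2 _ _ (Fin.rev_lt_rev.mpr hij)⟩

theorem antiTranspose_mem_elemMonoid {n : ℕ} {G : Matrix (Fin n) (Fin n) ℂ}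
    (hG : G ∈ elemMonoid n) : antiTranspose G ∈ elemMonoid n := by
  refine Submonoid.closure_induction (motive := fun x _ => antiTranspose x ∈ elemMonoid n) ?_ ?_ ?_ hG
  · rintro _ ⟨i, j, t, hij, ht, rfl⟩
    have : antiTranspose (Matrix.transvection i j t) = Matrix.transvection j.rev i.rev t := by
      ext a b
      simp only [antiTranspose, Matrix.transvection, Matrix.submatrix_apply,
        Matrix.transpose_apply, Matrix.add_apply, Matrix.one_apply, Matrix.single_apply,
        Fin.rev_inj]
      congr 1
      · simp only [eq_comm]
      · congr 1
        simp only [← Fin.rev_eq_iff, eq_iff_iff]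
        tauto
    rw [this]
    exact transvection_mem_elemMonoid (by simp only [Fin.val_rev]; omega) ht
  · have : antiTranspose (1 : Matrix (Fin n) (Fin n) ℂ) = 1 := by
      ext a b; simp [antiTranspose, Matrix.one_apply]
    rw [this]; exact one_mem _
  · intro x y _ _ h1 h2
    rw [antiTranspose_mul]; exact mul_mem h2 h1

/-! ### Neville elimination -/

/-- The entries of a square matrix, extended by zero to all pairs of natural numbers. -/
def natEntry {n : ℕ} (M : Matrix (Fin n) (Fin n) ℂ) (i j : ℕ) : ℂ :=
  if h : i < n ∧ j < n then M ⟨i, h.1⟩ ⟨j, h.2⟩ else 0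

theorem natEntry_of_lt {n : ℕ} {M : Matrix (Fin n) (Fin n) ℂ} {i j : ℕ} (hi : i < n) (hj : j < n) :
    natEntry M i j = M ⟨i, hi⟩ ⟨j, hj⟩ := dif_pos ⟨hi, hj⟩

theorem natEntry_val {n : ℕ} {M : Matrix (Fin n) (Fin n) ℂ} (i j : Fin n) :
    natEntry M i j = M i j := natEntry_of_lt i.2 j.2

/-- The matrix `1 - ∑_{0 < s ≤ l} t_s E_{s,s-1}`. -/
def bidiag (n : ℕ) (t : ℕ → ℂ) (l : ℕ) : Matrix (Fin n) (Fin n) ℂ :=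
  Matrix.of fun i j => (if i = j then 1 else 0) +
    if (i : ℕ) = j + 1 ∧ (i : ℕ) ≤ l then -t i else 0

theorem bidiag_mul_apply {n : ℕ} (t : ℕ → ℂ) (l : ℕ) (N : Matrix (Fin n) (Fin n) ℂ)
    {i i' : Fin n} (h : (i : ℕ) = i' + 1) (hl : (i : ℕ) ≤ l) (j : Fin n) :
    (bidiag n t l * N) i j = N i j - t i * N i' j := by
  simp only [bidiag, Matrix.mul_apply, Matrix.of_apply, add_mul, Finset.sum_add_distrib, ite_mul,
    one_mul, zero_mul, Finset.sum_ite_eq, Finset.mem_univ, if_true, sub_eq_add_neg, hl, and_true]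
  rw [Finset.sum_eq_single i']
  · rw [if_pos h, neg_mul]
  · intro k _ hk
    rw [if_neg]
    intro hik
    exact hk (Fin.ext (by omega))
  · simp

theorem bidiag_mul_apply_zero {n : ℕ} (t : ℕ → ℂ) (l : ℕ) (N : Matrix (Fin n) (Fin n) ℂ)
    {i : Fin n} (h : (i : ℕ) = 0) (j : Fin n) : (bidiag n t l * N) i j = N i j := by
  simp only [bidiag, Matrix.mul_apply, Matrix.of_apply, add_mul, Finset.sum_add_distrib, ite_mul,
    one_mul, zero_mul, Finset.sum_ite_eq, Finset.mem_univ, if_true, h]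
  simp

/-- The bidiagonal matrix is an ordered product of transvections with parameters -t_s, so its
inverse is the reversed product with parameters t_s. The cut-off `l` serves this induction. -/
theorem exists_mul_bidiag_eq_one {n : ℕ} {t : ℕ → ℂ} (ht : ∀ s, 0 ≤ t s) (l : ℕ) :
    ∃ G ∈ elemMonoid n, G * bidiag n t l = 1 := by
  induction l with
  | zero =>
    refine ⟨1, one_mem _, ?_⟩
    ext i j
    have : ¬ ((i : ℕ) = j + 1 ∧ (i : ℕ) ≤ 0) := by omega
    simp only [bidiag, one_mul, Matrix.of_apply, if_neg this, add_zero, Matrix.one_apply]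
  | succ l ih =>
    obtain ⟨G, hG, hGb⟩ := ih
    by_cases hl : l + 1 < n
    · have hb : bidiag n t (l + 1) = bidiag n t l *
          Matrix.transvection ⟨l + 1, hl⟩ ⟨l, by omega⟩ (-t (l + 1)) := by
        ext i j
        by_cases hj : j = ⟨l, by omega⟩
        · subst hj
          rw [Matrix.mul_transvection_apply_same]
          simp only [bidiag, Matrix.of_apply, Fin.ext_iff]
          have e2 : ¬ ((i : ℕ) = l + 1 + 1 ∧ (i : ℕ) ≤ l) := by omega
          have e3 : ¬ ((i : ℕ) = l + 1 ∧ (i : ℕ) ≤ l) := by omega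
          rw [if_neg e2, if_neg e3]
          by_cases hi : (i : ℕ) = l + 1
          · simp [hi]
          · simp [hi]
        · rw [Matrix.mul_transvection_apply_of_ne _ _ _ _ hj]
          simp only [bidiag, Matrix.of_apply]
          have hj' : (j : ℕ) ≠ l := fun h => hj (Fin.ext h)
          congr 1
          refine if_congr ?_ rfl rfl
          omega
      refine ⟨Matrix.transvection ⟨l + 1, hl⟩ ⟨l, by omega⟩ (t (l + 1)) * G,
        mul_mem (transvection_mem_elemMonoid rfl (ht _)) hG, ?_⟩
      rw [hb, mul_assoc, ← mul_assoc G, hGb, one_mul, Matrix.transvection_mul_transvection_same _ _ 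
        (by simp [Fin.ext_iff]), add_neg_cancel, Matrix.transvection_zero]
    · refine ⟨G, hG, ?_⟩
      rw [← hGb]
      congr 1
      ext i j
      simp only [bidiag, Matrix.of_apply]
      congr 1
      refine if_congr ?_ rfl rfl
      omega

/-- For every size, the minors of `Z` with consecutive rows `≥ m` and consecutive columns starting
from `m` are nonzero real numbers of the same sign. -/
def SignRegularFrom {n : ℕ} (Z : Matrix (Fin n) (Fin n) ℂ) (m : ℕ) : Prop :=
  ∀ p, ∃ σ : ℂ, ∀ s, m ≤ s → s + p ≤ n → m + p ≤ n → 0 < σ * denseMinor (natEntry Z) s m p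

/-- Subtracting multiples of preceding rows preserves the determinant and leaves a single entry in
the first column. Thus an elimination step lowers the size of the initial minors by one. -/
theorem denseMinor_eq_mul_of_row_reduction {A A' : ℕ → ℕ → ℂ} {t : ℕ → ℂ} {s m p : ℕ}
    (h : ∀ i < p, ∀ j ≤ p, A' (s + 1 + i) (m + j) =
      A (s + 1 + i) (m + j) - t (s + 1 + i) * A (s + i) (m + j))
    (h0 : ∀ i < p, A' (s + 1 + i) m = 0) :
    denseMinor A s m (p + 1) = A s m * denseMinor A' (s + 1) (m + 1) p := by
  let B : Matrix (Fin (p + 1)) (Fin (p + 1)) ℂ := Matrix.of fun i j =>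
    if (i : ℕ) = 0 then A s (m + j) else A' (s + i) (m + j)
  have hB : denseMinor A s m (p + 1) = B.det := by
    refine Matrix.det_eq_of_forall_row_eq_smul_add_pred (fun i => t (s + 1 + i)) ?_ ?_
    · intro j; simp [B]
    · intro i j
      have := h i i.2 j (by omega)
      simp only [B, Matrix.of_apply, Fin.val_succ, Fin.val_castSucc, Nat.succ_ne_zero, if_false]
      rw [show s + (i + 1 : ℕ) = s + 1 + i by ring, this]
      ring
  rw [hB, Matrix.det_succ_column_zero, Fin.sum_univ_succ, Finset.sum_eq_zero]
  · have : B.submatrix (Fin.succAbove 0) Fin.succ =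
        Matrix.of fun i j : Fin p => A' (s + 1 + i) (m + 1 + j) := by
      ext i j
      simp only [B, Matrix.submatrix_apply, Matrix.of_apply, Fin.succAbove_zero, Fin.val_succ,
        Nat.succ_ne_zero, if_false]
      congr 1 <;> ring
    rw [this]
    simp [B, denseMinor]
  · intro i _
    have := h0 i i.2
    have hBi : B i.succ 0 = 0 := by
      simp only [B, Matrix.of_apply, Fin.val_succ, Nat.succ_ne_zero, if_false, Fin.val_zero,
        add_zero]
      rw [show s + (i + 1 : ℕ) = s + 1 + i by ring, this]
    rw [hBi]; ring

/-- Neville elimination: the lower unitriangular factor of a matrix with sign-regular initial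
minors is a product of elementary matrices with nonnegative parameters. -/
theorem mem_elemMonoid_of_signRegular {n : ℕ} {A : Matrix (Fin n) (Fin n) ℂ}
    (hA : ∀ i j : Fin n, j < i → A i j = 0) :
    ∀ (k m : ℕ), m + k = n → ∀ N : Matrix (Fin n) (Fin n) ℂ, IsLowerUni N →
      (∀ i j : Fin n, (j : ℕ) < m → N i j = if i = j then 1 else 0) →
      SignRegularFrom (N * A) m → N ∈ elemMonoid n := by
  intro k
  induction k with
  | zero =>
    intro m hm N _ hN1 _
    have : N = 1 := by
      ext i j
      rw [hN1 i j (by omega), Matrix.one_apply]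
    rw [this]; exact one_mem _
  | succ k ih =>
    intro m hm N hN hN1 hsr
    set Z := N * A with hZ
    let mf : Fin n := ⟨m, by omega⟩
    have hcol : ∀ s : Fin n, m ≤ (s : ℕ) → Z s mf = N s mf * A mf mf := by
      intro s hs
      rw [hZ, Matrix.mul_apply, Finset.sum_eq_single mf]
      · intro j _ hj
        rcases hj.lt_or_gt with h | h
        · rw [hN1 s j h, if_neg, zero_mul]
          rintro rfl
          exact absurd h (by simp [mf, Fin.lt_def]; omega)
        · rw [hA _ _ h, mul_zero]
      · simp
    obtain ⟨σ, hσ⟩ := hsr 1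
    have hpos : ∀ s, m ≤ s → s < n → 0 < σ * natEntry Z s m := by
      intro s h1 h2
      have := hσ s h1 h2 (by omega)
      simpa [denseMinor] using this
    have hZne : ∀ s, m ≤ s → s < n → natEntry Z s m ≠ 0 := fun s h1 h2 h => by
      have := hpos s h1 h2
      simp [h] at this
    -- The Neville multipliers are ratios of adjacent entries of column m; equality of signs makes
    -- them positive. Column m of `Z` is a multiple of that of `N` from row m on, so the same
    -- operations clear both.
    let t : ℕ → ℂ := fun s => if m < s ∧ s < n then natEntry Z s m / natEntry Z (s - 1) m else 0
    have ht : ∀ s, 0 ≤ t s := by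
      intro s
      by_cases h : m < s ∧ s < n
      · have h1 := hpos s (by omega) h.2
        have h2 := hpos (s - 1) (by omega) (by omega)
        have hσ0 : σ ≠ 0 := by rintro rfl; simp at h1
        have := complex_div_pos h1 h2
        rw [mul_div_mul_left _ _ hσ0] at this
        simp only [t, if_pos h]
        exact this.le
      · simp only [t, if_neg h]; rfl
    obtain ⟨G, hG, hGb⟩ := exists_mul_bidiag_eq_one (n := n) ht n
    have ht0 : ∀ s, s ≤ m → t s = 0 := fun s hs => if_neg (by omega)
    set N' := bidiag n t n * N with hN'
    have hNN' : N = G * N' := by rw [hN', ← mul_assoc, hGb, one_mul]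
    have hrow0 : ∀ (i : Fin n) j, (i : ℕ) ≤ m → N' i j = N i j := by
      intro i j hi
      rcases Nat.eq_zero_or_pos i with h | h
      · exact bidiag_mul_apply_zero t n N h j
      · have hi1 : (i : ℕ) - 1 < n := by omega
        rw [hN', bidiag_mul_apply t n N (i' := ⟨i - 1, hi1⟩) (by simp; omega) i.2.le, ht0 _ hi]
        simp
    have hrow : ∀ (i i' : Fin n) j, (i : ℕ) = i' + 1 → N' i j = N i j - t i * N i' j :=
      fun i i' j h => bidiag_mul_apply t n N h i.2.le j
    have hpred : ∀ i : Fin n, m < (i : ℕ) → ∃ i' : Fin n, (i : ℕ) = i' + 1 := fun i hi =>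
      ⟨⟨i - 1, by omega⟩, by simp; omega⟩
    have hAmm : A mf mf ≠ 0 := by
      have h1 := hZne m le_rfl (by omega)
      rw [natEntry_of_lt (by omega) (by omega)] at h1
      rw [hcol mf le_rfl] at h1
      exact right_ne_zero_of_mul h1
    have hcol0 : ∀ i : Fin n, m < (i : ℕ) → N' i mf = 0 := by
      intro i hi
      obtain ⟨i', hi'⟩ := hpred i hi
      rw [hrow i i' mf hi']
      have h1 := hcol i hi.le
      have h2 := hcol i' (by omega)
      have h3 := hZne i' (by omega) i'.2
      have e1 : natEntry Z i m = Z i mf := natEntry_of_lt i.2 (by omega)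
      have e2 : natEntry Z i' m = Z i' mf := natEntry_of_lt i'.2 (by omega)
      have ht' : t i = Z i mf / Z i' mf := by
        simp only [t]
        rw [if_pos ⟨hi, i.2⟩, e1, ← e2]
        congr 2
        omega
      rw [e2] at h3
      rw [ht', h1, h2]
      rw [h2] at h3
      have h4 := left_ne_zero_of_mul h3
      field_simp
      ring
    have hN'l : IsLowerUni N' := by
      constructor
      · intro i
        rcases Nat.lt_or_ge m i with hi | hi
        · obtain ⟨i', hi'⟩ := hpred i hi
          rw [hrow i i' i hi', hN.1, hN.2 i' i (by rw [Fin.lt_def]; omega)]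
          ring
        · rw [hrow0 i i hi, hN.1]
      · intro i j hij
        rcases Nat.lt_or_ge m i with hi | hi
        · obtain ⟨i', hi'⟩ := hpred i hi
          rw [Fin.lt_def] at hij
          rw [hrow i i' j hi', hN.2 i j hij, hN.2 i' j (by rw [Fin.lt_def]; omega)]
          ring
        · rw [hrow0 i j hi, hN.2 i j hij]
    have hN'1 : ∀ i j : Fin n, (j : ℕ) < m + 1 → N' i j = if i = j then 1 else 0 := by
      intro i j hj
      rcases Nat.lt_or_ge m i with hi | hi
      · rcases Nat.lt_or_ge j m with hjm | hjm
        · obtain ⟨i', hi'⟩ := hpred i hi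
          rw [hrow i i' j hi', hN1 i j hjm, hN1 i' j hjm, if_neg (by rw [Fin.ext_iff]; omega),
            if_neg (by rw [Fin.ext_iff]; omega)]
          ring
        · obtain rfl : j = mf := Fin.ext (by simp [mf]; omega)
          rw [hcol0 i hi, if_neg (by rw [Fin.ext_iff]; simp [mf]; omega)]
      · rw [hrow0 i j hi]
        rcases Nat.lt_or_ge j m with hjm | hjm
        · exact hN1 i j hjm
        · rcases eq_or_ne i j with rfl | hne
          · rw [if_pos rfl, hN.1]
          · rw [if_neg hne, hN.2 _ _ (by rw [Fin.lt_def]; rw [Ne, Fin.ext_iff] at hne; omega)]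
    rw [hNN']
    refine mul_mem hG (ih (m + 1) (by omega) N' hN'l hN'1 ?_)
    have hZ' : N' * A = bidiag n t n * Z := by rw [hN', hZ, mul_assoc]
    have hZrow : ∀ s j, m ≤ s → s + 1 < n → j < n → natEntry (N' * A) (s + 1) j =
        natEntry Z (s + 1) j - t (s + 1) * natEntry Z s j := by
      intro s j _ hs hj
      rw [natEntry_of_lt hs hj, natEntry_of_lt hs hj, natEntry_of_lt (by omega) hj, hZ',
        bidiag_mul_apply t n Z (i' := ⟨s, by omega⟩) rfl (by simp; omega)]
    have hZcol : ∀ s, m ≤ s → s + 1 < n → natEntry (N' * A) (s + 1) m = 0 := by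
      intro s h1 h2
      rw [hZrow s m h1 h2 (by omega)]
      simp only [t]
      rw [if_pos ⟨by omega, h2⟩, Nat.add_sub_cancel, div_mul_cancel₀ _ (hZne s h1 (by omega)),
        sub_self]
    intro p
    obtain ⟨τ, hτ⟩ := hsr (p + 1)
    -- A minor of size p after the step is one of size p + 1 before it, of sign governed by τ,
    -- divided by an entry of sign governed by σ.
    refine ⟨τ / σ, fun s hs hsp hmp => ?_⟩
    obtain ⟨s, rfl⟩ : ∃ s', s = s' + 1 := ⟨s - 1, by omega⟩
    have h1 := hτ s (by omega) (by omega) (by omega)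
    have h2 := hpos s (by omega) (by omega)
    rw [denseMinor_eq_mul_of_row_reduction (A' := natEntry (N' * A)) (t := t)] at h1
    · have h3 := complex_div_pos h1 h2
      have h4 := hZne s (by omega) (by omega)
      have hσ0 : σ ≠ 0 := by rintro rfl; simp at h2
      convert h3 using 1
      field_simp
    · intro i hi j hj
      rw [show s + 1 + i = s + i + 1 by ring]
      exact hZrow (s + i) (m + j) (by omega) (by omega) (by omega)
    · intro i hi
      rw [show s + 1 + i = s + i + 1 by ring]
      exact hZcol (s + i) (by omega) (by omega)

theorem det_submatrix_rev_rev {n m : ℕ} (M : Matrix (Fin n) (Fin n) ℂ) (r c : Fin m → Fin n) :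
    (M.submatrix (r ∘ Fin.rev) (c ∘ Fin.rev)).det = (M.submatrix r c).det :=
  Matrix.det_submatrix_equiv_self Fin.revPerm (M.submatrix r c)

/-- A matrix that is totally positive up to the order of the rows has sign-regular initial
minors. -/
theorem IsRevTP.signRegularFrom {n : ℕ} {M : Matrix (Fin n) (Fin n) ℂ} (h : IsRevTP M) :
    SignRegularFrom M 0 := by
  intro p
  -- Restoring the order of p reversed rows costs the sign of the reversal, which depends only on p.
  refine ⟨((Equiv.Perm.sign (Fin.revPerm : Equiv.Perm (Fin p)) : ℤ) : ℂ), fun s _ hs hm => ?_⟩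
  have h1 := h p (fun a => ⟨n - (s + p) + a, by omega⟩) (fun a => ⟨a, by omega⟩)
    (fun a b hab => by rw [Fin.lt_def] at hab ⊢; simpa using hab)
    (fun a b hab => by rw [Fin.lt_def] at hab ⊢; simpa using hab)
  rw [denseMinor, ← Matrix.det_permute]
  convert h1 using 2
  ext a b
  simp only [Matrix.submatrix_apply, Matrix.of_apply, id_eq, Fin.revPerm_apply, Fin.val_rev]
  rw [natEntry_of_lt (by omega) (by omega)]
  congr 1
  · ext; simp only [Fin.val_rev]; omega
  · ext; simp

theorem IsRevTP.antiTranspose {n : ℕ} {M : Matrix (Fin n) (Fin n) ℂ} (h : IsRevTP M) :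
    IsRevTP (_root_.antiTranspose M) := by
  intro m r c hr hc
  have h1 := h m (fun a => c a) (fun a => r a) hc hr
  have : (((_root_.antiTranspose M).submatrix Fin.rev id).submatrix r c) =
      ((M.submatrix Fin.rev id).submatrix c r).transpose := by
    ext a b; simp [_root_.antiTranspose]
  rw [this, Matrix.det_transpose]
  exact h1

theorem IsRevTP.lower_mem_elemMonoid {n : ℕ} {M N A : Matrix (Fin n) (Fin n) ℂ} (h : IsRevTP M)
    (hN : IsLowerUni N) (hA : ∀ i j : Fin n, j < i → A i j = 0) (hM : M = N * A) :
    N ∈ elemMonoid n :=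
  mem_elemMonoid_of_signRegular hA n 0 (by simp) N hN (by simp) (hM ▸ h.signRegularFrom)

/-- Reflection in the antidiagonal reverses products and keeps both triangular shapes, which turns a
right factor into a left one. -/
theorem IsRevTP.lower_mem_elemMonoid' {n : ℕ} {M N A : Matrix (Fin n) (Fin n) ℂ} (h : IsRevTP M)
    (hN : IsLowerUni N) (hA : ∀ i j : Fin n, j < i → A i j = 0) (hM : M = A * N) :
    N ∈ elemMonoid n := by
  rw [← antiTranspose_antiTranspose N]
  refine antiTranspose_mem_elemMonoid (h.antiTranspose.lower_mem_elemMonoid hN.antiTranspose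
    (A := _root_.antiTranspose A) (fun i j hij => hA _ _ (Fin.rev_lt_rev.mpr hij)) ?_)
  rw [hM, antiTranspose_mul]

/-- Transfer of total positivity along `Ξ = τ(P) Ξ' τ(Q)`, where `P` and `Q` come from the
triangular factorizations of `Ξ'`. -/
theorem IsRevTP.of_shift_mul {n : ℕ} {Ξ V C : Matrix (Fin (n + 1)) (Fin (n + 1)) ℂ}
    (hV : IsLowerUni V) (hC : IsLowerUni C)
    (hA : ∀ i j : Fin (n + 1), j < i → (V * Ξ * shift C) i j = 0)
    (hB : ∀ i j : Fin (n + 1), j < i → (shift V * Ξ * C) i j = 0)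
    (h : IsRevTP (shift V * Ξ * shift C)) : IsRevTP Ξ := by
  obtain ⟨P, hP, hPV, -⟩ := hV.exists_inv
  obtain ⟨Q, hQ, -, hCQ⟩ := hC.exists_inv
  have sPV : shift P * shift V = 1 := by rw [← shift_mul hP, hPV, shift_one]
  have sCQ : shift C * shift Q = 1 := by rw [← shift_mul hC, hCQ, shift_one]
  -- The matrix τ(V) Ξ τ(C) is τ(V) P times the upper triangular V Ξ τ(C); for `hR` it is the upper
  -- triangular τ(V) Ξ C times Q τ(C).
  have hN : shift V * P ∈ elemMonoid (n + 1) := by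
    refine h.lower_mem_elemMonoid (hV.shift.mul hP) hA ?_
    rw [mul_assoc V, mul_assoc (shift V) P, ← mul_assoc P, hPV, one_mul, mul_assoc]
  have hR : Q * shift C ∈ elemMonoid (n + 1) := by
    refine h.lower_mem_elemMonoid' (hQ.mul hC.shift) hB ?_
    rw [mul_assoc (shift V * Ξ) C, ← mul_assoc C, hCQ, one_mul]
  have hPmem : P ∈ elemMonoid (n + 1) :=
    mem_elemMonoid_of_eq_shift_mul hP hN (by rw [← mul_assoc, sPV, one_mul])
  have hQmem : Q ∈ elemMonoid (n + 1) :=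
    mem_elemMonoid_of_eq_mul_shift hR (by rw [mul_assoc, sCQ, mul_one])
  have hΞ : Ξ = shift P * (shift V * Ξ * shift C) * shift Q := by
    simp only [mul_assoc, sCQ, mul_one]
    rw [← mul_assoc, sPV, one_mul]
  rw [hΞ]
  exact (h.elem_mul (shift_mem_elemMonoid hPmem)).mul_elem (shift_mem_elemMonoid hQmem)

/-! ### Block triangular determinants -/

theorem det_eq_of_blockTriangular {ι : Type*} [Fintype ι] [DecidableEq ι] {M M' : Matrix ι ι ℂ}
    {b : ι → ℤ} (h : M.BlockTriangular b) (h' : M'.BlockTriangular b)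
    (heq : ∀ i j, b i = b j → M i j = M' i j) : M.det = M'.det := by
  rw [h.det, h'.det]
  refine Finset.prod_congr rfl fun a _ => ?_
  congr 1
  ext i j
  exact heq _ _ (i.2.trans j.2.symm)

/-- In a block triangular matrix the last indices are split off if they form one block. -/
theorem det_split {M : ℕ → ℕ → ℂ} {b : ℕ → ℤ} {p q : ℕ} {c : ℤ}
    (hM : ∀ i < p + q, ∀ j < p + q, b j < b i → M i j = 0)
    (hp : ∀ i < p, b i ≠ c) (hq : ∀ i < q, b (p + i) = c) :
    (Matrix.of fun i j : Fin (p + q) => M i j).det =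
      (Matrix.of fun i j : Fin p => M i j).det *
        (Matrix.of fun i j : Fin q => M (p + i) (p + j)).det := by
  let N : Matrix (Fin p ⊕ Fin q) (Fin p ⊕ Fin q) ℂ :=
    (Matrix.of fun i j : Fin (p + q) => M i j).submatrix finSumFinEquiv finSumFinEquiv
  have h1 : (Matrix.of fun i j : Fin (p + q) => M i j).det = N.det :=
    (Matrix.det_submatrix_equiv_self _ _).symm
  let b' : Fin p ⊕ Fin q → ℤ := fun i => b (finSumFinEquiv i)
  -- Neither corner of `N` need vanish, but their entries join different blocks of `b'`, so erasing
  -- them does not change the determinant.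
  let N' : Matrix (Fin p ⊕ Fin q) (Fin p ⊕ Fin q) ℂ :=
    Matrix.fromBlocks (Matrix.of fun i j : Fin p => M i j) 0 0
      (Matrix.of fun i j : Fin q => M (p + i) (p + j))
  have hN : N.BlockTriangular b' := fun i j hij => hM _ (Fin.is_lt _) _ (Fin.is_lt _) hij
  have hN' : N'.BlockTriangular b' := by
    intro i j hij
    have := hN hij
    rcases i with i | i <;> rcases j with j | j
    · simpa [N, N'] using this
    · simp [N']
    · simp [N']
    · simpa [N, N'] using this
  have hb1 : ∀ i : Fin p, b' (.inl i) ≠ c := fun i => by simpa [b'] using hp i i.2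
  have hb2 : ∀ i : Fin q, b' (.inr i) = c := fun i => by simpa [b'] using hq i i.2
  rw [h1, det_eq_of_blockTriangular hN hN' ?_, Matrix.det_fromBlocks_zero₂₁]
  intro i j hij
  rcases i with i | i <;> rcases j with j | j
  · simp [N, N']
  · exact absurd (hij.trans (hb2 j)) (hb1 i)
  · exact absurd (hij.symm.trans (hb2 i)) (hb1 j)
  · simp [N, N']

/-! ### Staircase matrices -/

/-- An entry of the staircase matrix with blocks `A`, `B`: the row is the `o`-th one in block row
`a`, the column is the `w`-th one in block column `b`, both counted from the lower right corner. -/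
def stairEntry (n : ℕ) (A B : ℕ → ℕ → ℂ) (a o b w : ℕ) : ℂ :=
  if b = a + 1 then (if w < n then B (o + 1) (n - 1 - w) else 0)
  else if b = a then A o (n - w) else 0

/-- The staircase matrix, read from its lower right corner upwards and to the left; `e` is the
number of columns of the last block column that are used. -/
def stair (n e : ℕ) (A B : ℕ → ℕ → ℂ) (t u : ℕ) : ℂ :=
  stairEntry n A B (t / (n - 1)) (t % (n - 1)) ((u + (n + 1) - e) / (n + 1))
    ((u + (n + 1) - e) % (n + 1))

/-- The trailing minors of the staircase matrix. -/
def stairDet (n e : ℕ) (A B : ℕ → ℕ → ℂ) (p : ℕ) : ℂ :=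
  (Matrix.of fun t u : Fin p => stair n e A B t u).det

/-- The same lower unitriangular operation is applied in every block row. It uses only rows nearer
to the bottom, so cutting off at size p does no harm. -/
theorem stairDet_congr_of_row_op {n e : ℕ} (hn : 2 ≤ n) {A B A' B' V : ℕ → ℕ → ℂ}
    (hV : ∀ o < n - 1, V o o = 1)
    (hA : ∀ o < n - 1, ∀ j, A' o j = ∑ i ∈ Finset.range (o + 1), V o i * A i j)
    (hB : ∀ o < n - 1, ∀ j, B' (o + 1) j = ∑ i ∈ Finset.range (o + 1), V o i * B (i + 1) j)
    (p : ℕ) : stairDet n e A' B' p = stairDet n e A B p := by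
  have hd : 0 < n - 1 := by omega
  let L : ℕ → ℕ → ℂ := fun t u =>
    if u / (n - 1) = t / (n - 1) ∧ u ≤ t then V (t % (n - 1)) (u % (n - 1)) else 0
  have hmul : (Matrix.of fun t u : Fin p => stair n e A' B' t u) =
      (Matrix.of fun t u : Fin p => L t u) * (Matrix.of fun t u : Fin p => stair n e A B t u) := by
    ext t u
    simp only [Matrix.mul_apply, Matrix.of_apply]
    rw [Fin.sum_univ_eq_sum_range (fun k => L t k * stair n e A B k u) p]
    have ht := Nat.div_add_mod (t : ℕ) (n - 1)
    have hto := Nat.mod_lt (t : ℕ) hd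
    set a := (t : ℕ) / (n - 1) with ha
    set o := (t : ℕ) % (n - 1) with ho
    have hsub : Finset.Ico ((n - 1) * a) ((n - 1) * a + (o + 1)) ⊆ Finset.range p := by
      intro k hk
      have := t.2
      simp only [Finset.mem_Ico, Finset.mem_range] at hk ⊢
      omega
    rw [← Finset.sum_subset hsub]
    · rw [Finset.sum_Ico_eq_sum_range, Nat.add_sub_cancel_left]
      have hterm : ∀ i ∈ Finset.range (o + 1), L t ((n - 1) * a + i) *
          stair n e A B ((n - 1) * a + i) u = V o i *
          stairEntry n A B a i (((u : ℕ) + (n + 1) - e) / (n + 1))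
            (((u : ℕ) + (n + 1) - e) % (n + 1)) := by
        intro i hi
        rw [Finset.mem_range] at hi
        have h1 : ((n - 1) * a + i) / (n - 1) = a := by
          rw [Nat.mul_add_div hd, Nat.div_eq_of_lt (by omega), add_zero]
        have h2 : ((n - 1) * a + i) % (n - 1) = i := by
          rw [Nat.mul_add_mod, Nat.mod_eq_of_lt (by omega)]
        simp only [L, stair, h1, h2, ← ha, ← ho]
        rw [if_pos ⟨trivial, by omega⟩]
      rw [Finset.sum_congr rfl hterm]
      simp only [stair, ← ha, ← ho, stairEntry]
      split_ifs
      · exact hB o hto _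
      · simp
      · exact hA o hto _
      · simp
    · intro k _ hk
      have : ¬ (k / (n - 1) = a ∧ k ≤ t) := by
        rintro ⟨h1, h2⟩
        apply hk
        rw [Finset.mem_Ico]
        have := Nat.div_mul_le_self k (n - 1)
        rw [h1, mul_comm] at this
        omega
      rw [show L t k = 0 from if_neg this, zero_mul]
  have hL : (Matrix.of fun t u : Fin p => L t u).det = 1 := by
    rw [Matrix.det_of_isLowerTriangular]
    · refine Finset.prod_eq_one fun t _ => ?_
      simp only [Matrix.of_apply, L]
      rw [if_pos ⟨trivial, le_rfl⟩]
      exact hV _ (Nat.mod_lt _ hd)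
    · intro t u h
      have h : (t : ℕ) < u := h
      have : ¬ ((u : ℕ) / (n - 1) = t / (n - 1) ∧ (u : ℕ) ≤ t) := by omega
      simp only [Matrix.of_apply, L, if_neg this]
  rw [stairDet, hmul, Matrix.det_mul, hL, one_mul, stairDet]

/-- Column analogue. For e = 1 the minor begins with a lone column w = n of the last block column,
so that column must be left untouched: this is `hWn`. -/
theorem stairDet_congr_of_col_op {n e : ℕ} (he : e ≤ 1) {A B A' B' W : ℕ → ℕ → ℂ}
    (hW : ∀ w ≤ n, W w w = 1) (hWn : ∀ w < n, W w n = 0)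
    (hA : ∀ o, ∀ w ≤ n, A' o (n - w) = ∑ v ∈ Finset.range (w + 1), A o (n - v) * W v w)
    (hB : ∀ o, ∀ w < n, B' (o + 1) (n - 1 - w) =
      ∑ v ∈ Finset.range (w + 1), B (o + 1) (n - 1 - v) * W v w)
    (p : ℕ) : stairDet n e A' B' p = stairDet n e A B p := by
  have hd : 0 < n + 1 := by omega
  let R : ℕ → ℕ → ℂ := fun v u =>
    if (v + (n + 1) - e) / (n + 1) = (u + (n + 1) - e) / (n + 1) ∧ v ≤ u then
      W ((v + (n + 1) - e) % (n + 1)) ((u + (n + 1) - e) % (n + 1)) else 0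
  have hmul : (Matrix.of fun t u : Fin p => stair n e A' B' t u) =
      (Matrix.of fun t u : Fin p => stair n e A B t u) * (Matrix.of fun t u : Fin p => R t u) := by
    ext t u
    simp only [Matrix.mul_apply, Matrix.of_apply]
    rw [Fin.sum_univ_eq_sum_range (fun k => stair n e A B t k * R k u) p]
    have hu := Nat.div_add_mod ((u : ℕ) + (n + 1) - e) (n + 1)
    have huw := Nat.mod_lt ((u : ℕ) + (n + 1) - e) hd
    set b := ((u : ℕ) + (n + 1) - e) / (n + 1) with hb
    set w := ((u : ℕ) + (n + 1) - e) % (n + 1) with hw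
    have hentry : stair n e A' B' t u = ∑ v ∈ Finset.range (w + 1),
        stairEntry n A B ((t : ℕ) / (n - 1)) ((t : ℕ) % (n - 1)) b v * W v w := by
      simp only [stair, ← hb, ← hw, stairEntry]
      split_ifs with h1 h2 h3
      · rw [hB _ w h2]
        refine Finset.sum_congr rfl fun v hv => ?_
        rw [Finset.mem_range] at hv
        rw [if_pos (by omega)]
      · have hwn : w = n := by omega
        refine (Finset.sum_eq_zero fun v hv => ?_).symm
        rw [Finset.mem_range] at hv
        rcases Nat.lt_or_ge v n with h | h
        · rw [hwn, hWn v h, mul_zero]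
        · rw [if_neg (by omega), zero_mul]
      · exact hA _ w (by omega)
      · simp
    rw [hentry]
    by_cases hwn : w = n
    · rw [Finset.sum_eq_single w, Finset.sum_eq_single (u : ℕ)]
      · simp only [stair, R, ← hb, ← hw, le_refl, and_self, if_true]
      · intro v _ hvu
        simp only [R, ← hb, ← hw]
        split_ifs with h
        · have h1 := Nat.div_add_mod (v + (n + 1) - e) (n + 1)
          have h2 := Nat.mod_lt (v + (n + 1) - e) hd
          rw [h.1] at h1
          rw [hwn, hWn _ (by omega), mul_zero]
        · rw [mul_zero]
      · intro h; exact absurd (Finset.mem_range.mpr u.2) h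
      · intro v hv hvw
        rw [Finset.mem_range] at hv
        rw [hwn, hWn v (by omega), mul_zero]
      · intro h; simp at h
    · have hb1 : 1 ≤ b := Nat.one_le_iff_ne_zero.mpr fun h => by
        rw [h, mul_zero] at hu
        omega
      have hbn : n + 1 ≤ (n + 1) * b := Nat.le_mul_of_pos_right _ hb1
      have hsub : Finset.Ico ((n + 1) * b + e - (n + 1)) ((n + 1) * b + e - (n + 1) + (w + 1)) ⊆
          Finset.range p := by
        intro k hk
        have := u.2
        simp only [Finset.mem_Ico, Finset.mem_range] at hk ⊢
        omega
      rw [← Finset.sum_subset hsub]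
      · rw [Finset.sum_Ico_eq_sum_range, Nat.add_sub_cancel_left]
        refine Finset.sum_congr rfl fun i hi => ?_
        rw [Finset.mem_range] at hi
        have h0 : (n + 1) * b + e - (n + 1) + i + (n + 1) - e = (n + 1) * b + i := by omega
        have h1 : ((n + 1) * b + i) / (n + 1) = b := by
          rw [Nat.mul_add_div hd, Nat.div_eq_of_lt (by omega), add_zero]
        have h2 : ((n + 1) * b + i) % (n + 1) = i := by
          rw [Nat.mul_add_mod, Nat.mod_eq_of_lt (by omega)]
        simp only [R, stair, h0, h1, h2, ← hb, ← hw]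
        rw [if_pos ⟨trivial, by omega⟩]
      · intro k _ hk
        have : ¬ ((k + (n + 1) - e) / (n + 1) = b ∧ k ≤ u) := by
          rintro ⟨h1, h2⟩
          apply hk
          rw [Finset.mem_Ico]
          have := Nat.div_mul_le_self (k + (n + 1) - e) (n + 1)
          rw [h1, mul_comm] at this
          omega
        simp only [R, ← hb, if_neg this, mul_zero]
  have hR : (Matrix.of fun t u : Fin p => R t u).det = 1 := by
    rw [Matrix.det_of_isUpperTriangular]
    · refine Finset.prod_eq_one fun t _ => ?_
      simp only [Matrix.of_apply, R]
      rw [if_pos ⟨trivial, le_rfl⟩]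
      exact hW _ (Nat.le_of_lt_succ (Nat.mod_lt _ hd))
    · intro t u h
      have h : (u : ℕ) < t := h
      simp only [Matrix.of_apply, R]
      rw [if_neg (by omega)]
  rw [stairDet, hmul, Matrix.det_mul, hR, mul_one, stairDet]

/-! ### Factorization of the trailing minors -/

/-- Blocks have n - 1 rows but n + 1 columns, so the diagonal of the staircase drifts by 2 per
block. In block row a it runs through an `A` block for o < 2a + e and through a `B` block
afterwards. -/
theorem stair_eq_of_lt {n e a o a' o' : ℕ} {A B : ℕ → ℕ → ℂ} (ho : o < n - 1)
    (ho' : o' < 2 * a' + e) (hs : 2 * a' + e ≤ n + 1) :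
    stair n e A B ((n - 1) * a + o) ((n - 1) * a' + o') =
      stairEntry n A B a o a' (n + 1 + o' - (2 * a' + e)) := by
  have hd : 0 < n - 1 := by omega
  have h1 : ((n - 1) * a + o) / (n - 1) = a := by
    rw [Nat.mul_add_div hd, Nat.div_eq_of_lt ho, add_zero]
  have h2 : ((n - 1) * a + o) % (n - 1) = o := by
    rw [Nat.mul_add_mod, Nat.mod_eq_of_lt ho]
  have h0 : (n - 1) * a' + o' + (n + 1) - e = (n + 1) * a' + (n + 1 + o' - (2 * a' + e)) := by
    obtain ⟨k, rfl⟩ : ∃ k, n = k + 1 := ⟨n - 1, by omega⟩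
    have : (k + 1 + 1) * a' = k * a' + 2 * a' := by ring
    simp only [Nat.add_sub_cancel, this]
    omega
  have h3 : ((n + 1) * a' + (n + 1 + o' - (2 * a' + e))) / (n + 1) = a' := by
    rw [Nat.mul_add_div (by omega), Nat.div_eq_of_lt (by omega), add_zero]
  have h4 : ((n + 1) * a' + (n + 1 + o' - (2 * a' + e))) % (n + 1) =
      n + 1 + o' - (2 * a' + e) := by
    rw [Nat.mul_add_mod, Nat.mod_eq_of_lt (by omega)]
  rw [stair, h0, h1, h2, h3, h4]

theorem stair_eq_of_ge {n e a o a' o' : ℕ} {A B : ℕ → ℕ → ℂ} (ho : o < n - 1)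
    (ho' : 2 * a' + e ≤ o') (hn : o' < n - 1) :
    stair n e A B ((n - 1) * a + o) ((n - 1) * a' + o') =
      stairEntry n A B a o (a' + 1) (o' - (2 * a' + e)) := by
  have hd : 0 < n - 1 := by omega
  have h1 : ((n - 1) * a + o) / (n - 1) = a := by
    rw [Nat.mul_add_div hd, Nat.div_eq_of_lt ho, add_zero]
  have h2 : ((n - 1) * a + o) % (n - 1) = o := by
    rw [Nat.mul_add_mod, Nat.mod_eq_of_lt ho]
  have h0 : (n - 1) * a' + o' + (n + 1) - e = (n + 1) * (a' + 1) + (o' - (2 * a' + e)) := by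
    obtain ⟨k, rfl⟩ : ∃ k, n = k + 1 := ⟨n - 1, by omega⟩
    have : (k + 1 + 1) * (a' + 1) = k * a' + 2 * a' + (k + 1 + 1) := by ring
    simp only [Nat.add_sub_cancel, this]
    omega
  have h3 : ((n + 1) * (a' + 1) + (o' - (2 * a' + e))) / (n + 1) = a' + 1 := by
    rw [Nat.mul_add_div (by omega), Nat.div_eq_of_lt (by omega), add_zero]
  have h4 : ((n + 1) * (a' + 1) + (o' - (2 * a' + e))) % (n + 1) = o' - (2 * a' + e) := by
    rw [Nat.mul_add_mod, Nat.mod_eq_of_lt (by omega)]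
  rw [stair, h0, h1, h2, h3, h4]

/-- The position of an index in the block triangular order of the staircase matrix. -/
def stairKey (n e K t : ℕ) : ℤ :=
  if t % (n - 1) < 2 * (t / (n - 1)) + e then (t / (n - 1) : ℕ) else (K : ℤ) - (t / (n - 1) : ℕ)

/-- The order puts the `A` pieces of the diagonal first, by increasing block number, and then the
`B` pieces, by decreasing block number. `K` only has to be large enough to separate the two
families. -/
theorem stairKey_eq {n e K a o : ℕ} (ho : o < n - 1) : stairKey n e K ((n - 1) * a + o) =
    if o < 2 * a + e then (a : ℤ) else (K : ℤ) - a := by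
  have hd : 0 < n - 1 := by omega
  have h1 : ((n - 1) * a + o) / (n - 1) = a := by
    rw [Nat.mul_add_div hd, Nat.div_eq_of_lt ho, add_zero]
  have h2 : ((n - 1) * a + o) % (n - 1) = o := by
    rw [Nat.mul_add_mod, Nat.mod_eq_of_lt ho]
  rw [stairKey, h1, h2]

/-- If `A` and `B` are upper triangular in the first `m` columns, the staircase matrix is block
triangular. -/
theorem stair_eq_zero_of_stairKey_lt {n e m K p : ℕ} {A B : ℕ → ℕ → ℂ} (hn : 2 ≤ n)
    (hA : ∀ i j, j < m → j < i → A i j = 0) (hB : ∀ i j, j < m → j < i → B i j = 0)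
    (hK : ∀ t < p, 2 * (t / (n - 1)) < K)
    (h1 : ∀ t < p, 2 * (t / (n - 1)) + e ≤ m + 1) (hmn : m ≤ n)
    (h2 : ∀ t < p, 2 * (t / (n - 1)) + e ≤ t % (n - 1) → 2 * (t / (n - 1)) + e ≤ m) :
    ∀ t < p, ∀ u < p, stairKey n e K u < stairKey n e K t → stair n e A B t u = 0 := by
  intro t ht u hu
  have hd : 0 < n - 1 := by omega
  have ht0 := Nat.div_add_mod t (n - 1)
  have hu0 := Nat.div_add_mod u (n - 1)
  have hto := Nat.mod_lt t hd
  have huo := Nat.mod_lt u hd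
  have a1 := hK t ht
  have a2 := hK u hu
  have a3 := h1 t ht
  have a4 := h1 u hu
  have a5 := h2 t ht
  generalize t / (n - 1) = a at *
  generalize t % (n - 1) = o at *
  generalize u / (n - 1) = a' at *
  generalize u % (n - 1) = o' at *
  subst ht0 hu0
  rw [stairKey_eq hto, stairKey_eq huo]
  by_cases ho' : o' < 2 * a' + e
  · rw [stair_eq_of_lt hto ho' (by omega), if_pos ho', stairEntry]
    by_cases ho : o < 2 * a + e
    · rw [if_pos ho]
      intro h
      rw [if_neg (by omega), if_neg (by omega)]
    · intro _
      split_ifs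
      · refine hB _ _ ?_ ?_ <;> omega
      · rfl
      · refine hA _ _ ?_ ?_ <;> omega
      · rfl
  · rw [stair_eq_of_ge hto (by omega) huo, if_neg ho', stairEntry]
    by_cases ho : o < 2 * a + e
    · rw [if_pos ho]
      intro h
      omega
    · rw [if_neg ho]
      intro h
      rw [if_neg (by omega), if_neg (by omega)]

/-- Splitting off a minor of `A` from a trailing minor of the staircase matrix. -/
theorem stairDet_eq_mul_left {n e m a q : ℕ} {A B : ℕ → ℕ → ℂ} (hn : 2 ≤ n)
    (hA : ∀ i j, j < m → j < i → A i j = 0) (hB : ∀ i j, j < m → j < i → B i j = 0)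
    (hmn : m ≤ n) (hm : 2 * a + e ≤ m + 1) (hq : q ≤ 2 * a + e) (hqn : q ≤ n - 1) :
    stairDet n e A B ((n - 1) * a + q) = stairDet n e A B ((n - 1) * a) *
      (Matrix.of fun i j : Fin q => A i (2 * a + e - 1 - j)).det := by
  have hd : 0 < n - 1 := by omega
  have hdiv : ∀ t < (n - 1) * a + q, t / (n - 1) ≤ a ∧ (t / (n - 1) = a → t % (n - 1) < q) := by
    intro t ht
    have h1 := Nat.div_add_mod t (n - 1)
    constructor
    · by_contra! h
      have : (n - 1) * (a + 1) ≤ (n - 1) * (t / (n - 1)) := Nat.mul_le_mul_left _ h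
      rw [mul_add, mul_one] at this
      omega
    · intro h
      rw [h] at h1
      omega
  have h0 : ∀ i < q, stairKey n e (2 * a + 1) ((n - 1) * a + i) = a := by
    intro i hi
    rw [stairKey_eq (by omega), if_pos (by omega)]
  -- The value 2a + e = m + 1 is allowed because the last block row stops before its `B` piece. This
  -- gives access to minors of `A` that involve the uncleared column m.
  have h := det_split (M := stair n e A B) (b := stairKey n e (2 * a + 1)) (c := a)
    (p := (n - 1) * a) (q := q)
    (stair_eq_zero_of_stairKey_lt hn hA hB (fun t ht => by have := hdiv t ht; omega)
      (fun t ht => by have := hdiv t ht; omega) hmn (fun t ht h => by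
        have := hdiv t ht
        rcases Nat.lt_or_ge (t / (n - 1)) a with h' | h'
        · omega
        · have := this.2 (by omega); omega))
    (fun i hi => by
      have : i / (n - 1) < a := Nat.div_lt_of_lt_mul hi
      rw [stairKey]
      split_ifs
      · exact_mod_cast this.ne
      · push_cast; omega)
    h0
  rw [stairDet, h, stairDet]
  congr 2
  ext i j
  simp only [Matrix.of_apply]
  rw [stair_eq_of_lt (by omega) (by omega) (by omega), stairEntry, if_neg (by omega), if_pos rfl]
  congr 1
  omega

/-- Splitting off a minor of `B` from a trailing minor of the staircase matrix. -/
theorem stairDet_eq_mul_right {n e m a q : ℕ} {A B : ℕ → ℕ → ℂ} (hn : 2 ≤ n)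
    (hA : ∀ i j, j < m → j < i → A i j = 0) (hB : ∀ i j, j < m → j < i → B i j = 0)
    (hmn : m ≤ n) (hm : 2 * a + e ≤ m) (hq : 2 * a + e + q ≤ n - 1) :
    stairDet n e A B ((n - 1) * a + (2 * a + e) + q) =
      stairDet n e A B ((n - 1) * a + (2 * a + e)) *
      (Matrix.of fun i j : Fin q => B (2 * a + e + 1 + i) (n - 1 - j)).det := by
  rcases Nat.eq_zero_or_pos q with rfl | hq0
  · simp
  have hd : 0 < n - 1 := by omega
  have hdiv : ∀ t < (n - 1) * a + (2 * a + e) + q, t / (n - 1) ≤ a := by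
    intro t ht
    have h1 := Nat.div_add_mod t (n - 1)
    by_contra! h
    have : (n - 1) * (a + 1) ≤ (n - 1) * (t / (n - 1)) := Nat.mul_le_mul_left _ h
    rw [mul_add, mul_one] at this
    omega
  have h0 : ∀ i < q, stairKey n e (2 * a + 1) ((n - 1) * a + (2 * a + e) + i) =
      ((2 * a + 1 : ℕ) : ℤ) - a := by
    intro i hi
    rw [add_assoc, stairKey_eq (by omega), if_neg (by omega)]
  have h := det_split (M := stair n e A B) (b := stairKey n e (2 * a + 1))
    (c := ((2 * a + 1 : ℕ) : ℤ) - a) (p := (n - 1) * a + (2 * a + e)) (q := q)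
    (stair_eq_zero_of_stairKey_lt hn hA hB (fun t ht => by have := hdiv t ht; omega)
      (fun t ht => by have := hdiv t ht; omega) hmn (fun t ht h => by
        have := hdiv t ht; omega))
    (fun i hi => by
      have h1 := Nat.div_add_mod i (n - 1)
      have h2 := hdiv i (by omega)
      rw [stairKey]
      split_ifs with h3
      · push_cast; omega
      · intro h4
        have h5 : i / (n - 1) = a := by omega
        rw [h5] at h1 h3
        omega)
    h0
  rw [stairDet, h, stairDet]
  congr 2
  ext i j
  simp only [Matrix.of_apply]
  rw [add_assoc _ _ (i : ℕ), add_assoc _ _ (j : ℕ),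
    stair_eq_of_ge (by omega) (by omega) (by omega), stairEntry, if_pos rfl, if_pos (by omega)]
  congr 1 <;> omega

/-! ### Unitriangular operations on the blocks of a staircase matrix -/

theorem natEntry_eq_zero {n : ℕ} {M : Matrix (Fin n) (Fin n) ℂ} {i j : ℕ} (h : n ≤ i ∨ n ≤ j) :
    natEntry M i j = 0 := dif_neg (by omega)

theorem natEntry_mul {n : ℕ} (M N : Matrix (Fin n) (Fin n) ℂ) (i j : ℕ) :
    natEntry (M * N) i j = ∑ k ∈ Finset.range n, natEntry M i k * natEntry N k j := by
  by_cases h : i < n ∧ j < n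
  · rw [natEntry_of_lt h.1 h.2, Matrix.mul_apply,
      ← Fin.sum_univ_eq_sum_range (fun k => natEntry M i k * natEntry N k j)]
    refine Finset.sum_congr rfl fun k _ => ?_
    rw [natEntry_of_lt h.1 k.2, natEntry_of_lt k.2 h.2]
  · have h' : n ≤ i ∨ n ≤ j := by omega
    rw [natEntry_eq_zero h']
    refine (Finset.sum_eq_zero fun k _ => ?_).symm
    rcases h' with h' | h'
    · rw [natEntry_eq_zero (Or.inl h'), zero_mul]
    · rw [natEntry_eq_zero (Or.inr h'), mul_zero]

theorem natEntry_shift_succ_succ {n : ℕ} (C : Matrix (Fin (n + 1)) (Fin (n + 1)) ℂ) {i j : ℕ}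
    (hi : i < n) (hj : j < n) : natEntry (shift C) (i + 1) (j + 1) = natEntry C i j := by
  rw [natEntry_of_lt (by omega) (by omega), natEntry_of_lt (by omega) (by omega)]
  exact shift_succ_succ ⟨i, hi⟩ ⟨j, hj⟩

theorem natEntry_shift_zero_succ {n : ℕ} (C : Matrix (Fin (n + 1)) (Fin (n + 1)) ℂ) (j : ℕ) :
    natEntry (shift C) 0 (j + 1) = 0 := by
  rcases Nat.lt_or_ge j n with hj | hj
  · rw [natEntry_of_lt (by omega) (by omega)]
    exact shift_zero_succ ⟨j, hj⟩
  · exact natEntry_eq_zero (Or.inr (by omega))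

theorem natEntry_shift_succ_zero {n : ℕ} (C : Matrix (Fin (n + 1)) (Fin (n + 1)) ℂ) (j : ℕ) :
    natEntry (shift C) (j + 1) 0 = 0 := by
  rcases Nat.lt_or_ge j n with hj | hj
  · rw [natEntry_of_lt (by omega) (by omega)]
    exact shift_succ_zero ⟨j, hj⟩
  · exact natEntry_eq_zero (Or.inl (by omega))

theorem natEntry_shift_zero_zero {n : ℕ} (C : Matrix (Fin (n + 1)) (Fin (n + 1)) ℂ) :
    natEntry (shift C) 0 0 = 1 := by
  rw [natEntry_of_lt (by omega) (by omega)]; rfl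

namespace IsLowerUni

theorem natEntry_self {n : ℕ} {V : Matrix (Fin n) (Fin n) ℂ} (hV : IsLowerUni V) {i : ℕ}
    (hi : i < n) : natEntry V i i = 1 := by
  rw [natEntry_of_lt hi hi, hV.1]

theorem natEntry_of_lt {n : ℕ} {V : Matrix (Fin n) (Fin n) ℂ} (hV : IsLowerUni V) {i j : ℕ}
    (h : i < j) : natEntry V i j = 0 := by
  rcases Nat.lt_or_ge j n with hj | hj
  · rw [_root_.natEntry_of_lt (h.trans hj) hj]
    exact hV.2 _ _ h
  · exact natEntry_eq_zero (Or.inr hj)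

theorem natEntry_mul_eq_sum {n : ℕ} {V : Matrix (Fin n) (Fin n) ℂ} (hV : IsLowerUni V)
    (A : Matrix (Fin n) (Fin n) ℂ) {i p : ℕ} (hi : i < p) (hp : p ≤ n) (j : ℕ) :
    natEntry (V * A) i j = ∑ k ∈ Finset.range p, natEntry V i k * natEntry A k j := by
  rw [natEntry_mul]
  refine (Finset.sum_subset (Finset.range_subset_range.mpr hp) fun k _ hk => ?_).symm
  rw [Finset.mem_range, not_lt] at hk
  rw [hV.natEntry_of_lt (hi.trans_le hk), zero_mul]

theorem natEntry_mul_eq_sum' {n : ℕ} {C : Matrix (Fin n) (Fin n) ℂ} (hC : IsLowerUni C)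
    (A : Matrix (Fin n) (Fin n) ℂ) (i : ℕ) {w p : ℕ} (hw : w < p) (hp : p ≤ n) :
    natEntry (A * C) i (n - 1 - w) =
      ∑ v ∈ Finset.range p, natEntry A i (n - 1 - v) * natEntry C (n - 1 - v) (n - 1 - w) := by
  rw [natEntry_mul, ← Finset.sum_range_reflect]
  refine (Finset.sum_subset (Finset.range_subset_range.mpr hp) fun k hk hkp => ?_).symm
  rw [Finset.mem_range] at hk hkp
  rw [hC.natEntry_of_lt (by omega), mul_zero]

theorem det_natEntry_mul_left {n p : ℕ} {V : Matrix (Fin n) (Fin n) ℂ} (hV : IsLowerUni V)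
    (A : Matrix (Fin n) (Fin n) ℂ) (hp : p ≤ n) (c : Fin p → ℕ) :
    (Matrix.of fun i j : Fin p => natEntry (V * A) i (c j)).det =
      (Matrix.of fun i j : Fin p => natEntry A i (c j)).det := by
  have : (Matrix.of fun i j : Fin p => natEntry (V * A) i (c j)) =
      (Matrix.of fun i j : Fin p => natEntry V i j) *
        Matrix.of fun i j : Fin p => natEntry A i (c j) := by
    ext i j
    rw [Matrix.of_apply, hV.natEntry_mul_eq_sum A i.2 hp, Matrix.mul_apply,
      ← Fin.sum_univ_eq_sum_range (fun k => natEntry V i k * natEntry A k (c j))]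
    rfl
  rw [this, Matrix.det_mul, Matrix.det_of_isLowerTriangular, Finset.prod_eq_one, one_mul]
  · intro i _; exact hV.natEntry_self (by omega)
  · intro i j h; exact hV.natEntry_of_lt h

theorem det_natEntry_mul_right {n p : ℕ} {C : Matrix (Fin n) (Fin n) ℂ} (hC : IsLowerUni C)
    (A : Matrix (Fin n) (Fin n) ℂ) (hp : p ≤ n) (r : Fin p → ℕ) :
    (Matrix.of fun i j : Fin p => natEntry (A * C) (r i) (n - 1 - j)).det =
      (Matrix.of fun i j : Fin p => natEntry A (r i) (n - 1 - j)).det := by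
  have : (Matrix.of fun i j : Fin p => natEntry (A * C) (r i) (n - 1 - j)) =
      (Matrix.of fun i j : Fin p => natEntry A (r i) (n - 1 - j)) *
        Matrix.of fun i j : Fin p => natEntry C (n - 1 - i) (n - 1 - j) := by
    ext i j
    rw [Matrix.of_apply, hC.natEntry_mul_eq_sum' A (r i) j.2 hp, Matrix.mul_apply,
      ← Fin.sum_univ_eq_sum_range (fun v => natEntry A (r i) (n - 1 - v) *
        natEntry C (n - 1 - v) (n - 1 - j))]
    rfl
  have hR : (Matrix.of fun i j : Fin p => natEntry C (n - 1 - i) (n - 1 - j)).det = 1 := by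
    rw [Matrix.det_of_isUpperTriangular]
    · exact Finset.prod_eq_one fun i _ => hC.natEntry_self (by omega)
    · intro i j h
      rw [id_eq, id_eq, Fin.lt_def] at h
      exact hC.natEntry_of_lt (by omega)
  rw [this, Matrix.det_mul, hR, mul_one]

/-- In each block row, row o of `A` stands beside row o + 1 of `B`; this offset is why `B` is
multiplied by the shift of `V`. -/
theorem stairDet_mul_left {n e : ℕ} (hn : 1 ≤ n) {V : Matrix (Fin (n + 1)) (Fin (n + 1)) ℂ}
    (hV : IsLowerUni V) (A B : Matrix (Fin (n + 1)) (Fin (n + 1)) ℂ) (p : ℕ) :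
    stairDet (n + 1) e (natEntry (V * A)) (natEntry (_root_.shift V * B)) p =
      stairDet (n + 1) e (natEntry A) (natEntry B) p := by
  refine stairDet_congr_of_row_op (by omega) (V := natEntry V) ?_ ?_ ?_ p
  · intro o ho; exact hV.natEntry_self (by omega)
  · intro o ho j
    exact hV.natEntry_mul_eq_sum A (by omega) (by omega) j
  · intro o ho j
    rw [hV.shift.natEntry_mul_eq_sum B (p := o + 2) (by omega) (by omega), Finset.sum_range_succ',
      natEntry_shift_succ_zero, zero_mul, add_zero]
    refine Finset.sum_congr rfl fun k hk => ?_
    rw [Finset.mem_range] at hk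
    rw [natEntry_shift_succ_succ _ (by omega) (by omega)]

/-- In each block column, column j of `A` stands opposite column j - 1 of `B`, hence the shift on
the `A` side. Column 0 of `A` is opposite the zero column, and τ(C) leaves it alone. -/
theorem stairDet_mul_right {n e : ℕ} (he : e ≤ 1) {C : Matrix (Fin (n + 1)) (Fin (n + 1)) ℂ}
    (hC : IsLowerUni C) (A B : Matrix (Fin (n + 1)) (Fin (n + 1)) ℂ) (p : ℕ) :
    stairDet (n + 1) e (natEntry (A * _root_.shift C)) (natEntry (B * C)) p =
      stairDet (n + 1) e (natEntry A) (natEntry B) p := by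
  refine stairDet_congr_of_col_op he (W := fun v w =>
    if w = n + 1 then (if v = n + 1 then 1 else 0)
    else if v ≤ w then natEntry C (n - v) (n - w) else 0) ?_ ?_ ?_ ?_ p
  · intro w hw
    split_ifs
    · rfl
    · exact hC.natEntry_self (by omega)
    · omega
  · intro w hw
    rw [if_pos rfl, if_neg (by omega)]
  · intro o w hw
    rcases hw.eq_or_lt with rfl | hw
    · rw [Finset.sum_eq_single (n + 1)]
      · rw [if_pos rfl, if_pos rfl, Nat.sub_self, natEntry_mul, Finset.sum_eq_single 0,
          natEntry_shift_zero_zero]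
        · intro k _ hk
          obtain ⟨k, rfl⟩ := Nat.exists_eq_succ_of_ne_zero hk
          rw [Nat.succ_eq_add_one, natEntry_shift_succ_zero, mul_zero]
        · simp
      · intro v _ hv
        rw [if_pos rfl, if_neg hv, mul_zero]
      · simp
    · have hsub : Finset.range (w + 1) ⊆ Finset.range (n + 1 + 1) :=
        Finset.range_subset_range.mpr (by omega)
      rw [Finset.sum_subset hsub, ← Finset.sum_range_reflect, Finset.sum_range_succ, natEntry_mul]
      · rw [show n + 1 - (n + 1 + 1 - 1 - (n + 1)) = n + 1 by omega,
          natEntry_eq_zero (M := A) (Or.inr le_rfl), zero_mul, add_zero]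
        refine Finset.sum_congr rfl fun k hk => ?_
        rw [Finset.mem_range] at hk
        rw [show n + 1 - (n + 1 + 1 - 1 - k) = k by omega]
        congr 1
        rw [if_neg (by omega)]
        rcases Nat.eq_zero_or_pos k with rfl | hk0
        · rw [if_neg (by omega), show n + 1 - w = (n - w) + 1 by omega, natEntry_shift_zero_succ]
        · obtain ⟨k, rfl⟩ : ∃ k', k = k' + 1 := ⟨k - 1, by omega⟩
          rw [show n - (n + 1 + 1 - 1 - (k + 1)) = k by omega]
          rcases Nat.eq_zero_or_pos w with rfl | hw0
          · rw [natEntry_eq_zero (Or.inr (by omega)), if_neg (by omega)]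
          · rw [show n + 1 - w = (n - w) + 1 by omega,
              natEntry_shift_succ_succ _ (by omega) (by omega)]
            split_ifs with h
            · rfl
            · exact hC.natEntry_of_lt (by omega)
      · intro v _ hv
        rw [Finset.mem_range] at hv
        rw [if_neg (by omega), if_neg (by omega), mul_zero]
  · intro o w hw
    rw [hC.natEntry_mul_eq_sum' B (o + 1) (p := w + 1) (by omega) (by omega)]
    refine Finset.sum_congr rfl fun v hv => ?_
    rw [Finset.mem_range] at hv
    rw [if_neg (by omega), if_pos (by omega), Nat.add_sub_cancel]

end IsLowerUni

/-! ### Simultaneous triangularization -/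

/-- The unitriangular matrix `1 + ∑_{i > m} y_i E_{i,m}`. -/
def colUni (n m : ℕ) (y : ℕ → ℂ) : Matrix (Fin n) (Fin n) ℂ :=
  Matrix.of fun i j => (if i = j then 1 else 0) + if (j : ℕ) = m ∧ m < (i : ℕ) then y i else 0

theorem isLowerUni_colUni (n m : ℕ) (y : ℕ → ℂ) : IsLowerUni (colUni n m y) := by
  constructor
  · intro i
    have : ¬ ((i : ℕ) = m ∧ m < (i : ℕ)) := by omega
    simp only [colUni, Matrix.of_apply, if_neg this, if_true, add_zero]
  · intro i j h
    have : ¬ ((j : ℕ) = m ∧ m < (i : ℕ)) := by rw [Fin.lt_def] at h; omega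
    simp only [colUni, Matrix.of_apply, if_neg this, if_neg h.ne, add_zero]

theorem shift_colUni (n m : ℕ) (y : ℕ → ℂ) :
    shift (colUni (n + 1) m y) = colUni (n + 1) (m + 1) fun i => y (i - 1) := by
  ext i j
  refine Fin.cases ?_ (fun i => ?_) i <;> refine Fin.cases ?_ (fun j => ?_) j
  · simp [colUni]
  · simp [colUni, (Fin.succ_ne_zero j).symm]
  · simp [colUni]
  · simp [colUni]

theorem mul_colUni_of_ne {n m : ℕ} {y : ℕ → ℂ} (M : Matrix (Fin n) (Fin n) ℂ) (i : Fin n)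
    {j : Fin n} (hj : (j : ℕ) ≠ m) : (M * colUni n m y) i j = M i j := by
  simp [Matrix.mul_apply, colUni, hj]

theorem mul_colUni_same {n m : ℕ} {y : ℕ → ℂ} (M : Matrix (Fin n) (Fin n) ℂ) (i : Fin n)
    {j : Fin n} (hj : (j : ℕ) = m) : (M * colUni n m y) i j =
      M i j + ∑ k : Fin n, if m < (k : ℕ) then M i k * y k else 0 := by
  simp [Matrix.mul_apply, colUni, hj, mul_add, Finset.sum_add_distrib]

theorem colUni_mul_of_le {n m : ℕ} {y : ℕ → ℂ} (M : Matrix (Fin n) (Fin n) ℂ) {i : Fin n}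
    (hi : (i : ℕ) ≤ m) (j : Fin n) : (colUni n m y * M) i j = M i j := by
  have : ¬ m < (i : ℕ) := by omega
  simp [Matrix.mul_apply, colUni, this]

theorem colUni_mul_of_lt {n m : ℕ} {y : ℕ → ℂ} (M : Matrix (Fin n) (Fin n) ℂ) {i : Fin n}
    (hi : m < (i : ℕ)) (j : Fin n) :
    (colUni n m y * M) i j = M i j + y i * M ⟨m, hi.trans i.2⟩ j := by
  simp only [Matrix.mul_apply, colUni, Matrix.of_apply, hi, and_true, add_mul,
    Finset.sum_add_distrib]
  congr 1
  · simp
  · rw [Finset.sum_eq_single ⟨m, hi.trans i.2⟩]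
    · simp
    · intro k _ hk
      rw [if_neg (fun h => hk (Fin.ext h)), zero_mul]
    · simp

/-- `M` is upper triangular in the first `m` columns. -/
def UpperTo {n : ℕ} (m : ℕ) (M : Matrix (Fin n) (Fin n) ℂ) : Prop :=
  ∀ i j : Fin n, (j : ℕ) < m → j < i → M i j = 0

theorem UpperTo.natEntry {n m : ℕ} {M : Matrix (Fin n) (Fin n) ℂ} (h : UpperTo m M) :
    ∀ i j, j < m → j < i → natEntry M i j = 0 := by
  intro i j hj hij
  by_cases hi : i < n
  · rw [natEntry_of_lt hi (hij.trans hi)]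
    exact h _ _ hj hij
  · exact natEntry_eq_zero (Or.inl (by omega))

/-- The solution of the linear system that clears the `m`-th column of `B` below the diagonal. -/
theorem exists_sum_eq_neg {n m : ℕ} (B : Matrix (Fin (n + 1)) (Fin (n + 1)) ℂ) (hm : m < n)
    (hdet : (Matrix.of fun i j : Fin (n - m) => natEntry B (m + 1 + i) (n - j)).det ≠ 0) :
    ∃ y : ℕ → ℂ, ∀ i : Fin (n + 1), m < (i : ℕ) →
      B i ⟨m, by omega⟩ + ∑ k : Fin (n + 1), (if m < (k : ℕ) then B i k * y k else 0) = 0 := by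
  set D : Matrix (Fin (n - m)) (Fin (n - m)) ℂ :=
    Matrix.of fun i j => natEntry B (m + 1 + i) (n - j) with hD
  let b : Fin (n - m) → ℂ := fun i => -natEntry B (m + 1 + i) m
  have hz : D.mulVec (D⁻¹.mulVec b) = b := by
    rw [Matrix.mulVec_mulVec, Matrix.mul_nonsing_inv D (isUnit_iff_ne_zero.mpr hdet),
      Matrix.one_mulVec]
  set z := D⁻¹.mulVec b
  let z' : ℕ → ℂ := fun j => if h : j < n - m then z ⟨j, h⟩ else 0
  -- The columns of `D` run from right to left, so the unknown attached to index i is number n - i.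
  refine ⟨fun i => z' (n - i), fun i hi => ?_⟩
  have h1 := congrFun hz ⟨i - (m + 1), by omega⟩
  simp only [b, Matrix.mulVec, dotProduct, hD, Matrix.of_apply] at h1
  rw [show m + 1 + ((i : ℕ) - (m + 1)) = i by omega, natEntry_of_lt i.2 (by omega)] at h1
  rw [eq_neg_iff_add_eq_zero] at h1
  refine Eq.trans ?_ h1
  rw [add_comm]
  congr 1
  dsimp only
  have e1 : ∑ k : Fin (n + 1), (if m < (k : ℕ) then B i k * z' (n - k) else 0) =
      ∑ k ∈ Finset.range (n + 1), (if m < k then natEntry B i k * z' (n - k) else 0) := by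
    rw [← Fin.sum_univ_eq_sum_range
      (fun k => if m < k then natEntry B i k * z' (n - k) else 0)]
    simp only [natEntry_val]
  have e2 : ∑ x : Fin (n - m), natEntry B i (n - x) * z x =
      ∑ k ∈ Finset.range (n - m), natEntry B i (n - k) * z' k := by
    rw [← Fin.sum_univ_eq_sum_range (fun k => natEntry B i (n - k) * z' k)]
    refine Finset.sum_congr rfl fun k _ => ?_
    simp [z']
  rw [e1, e2, ← Finset.sum_range_reflect]
  refine (Finset.sum_subset_zero_on_sdiff (Finset.range_subset_range.mpr (by omega)) ?_ ?_).symm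
  · intro k hk
    simp only [Finset.mem_sdiff, Finset.mem_range] at hk
    rw [if_neg (by omega)]
  · intro k hk
    rw [Finset.mem_range] at hk
    rw [if_pos (by omega), show n + 1 - 1 - k = n - k by omega, show n - (n - k) = k by omega]

/-- The trailing minors of the staircase matrix built from `Ξ` that occur in the seed are
positive. -/
def StairPos {n : ℕ} (Ξ : Matrix (Fin (n + 1)) (Fin (n + 1)) ℂ) : Prop :=
  ∀ a e q : ℕ, e ≤ 1 → 2 * a + e ≤ n → q ≤ n →
    0 < stairDet (n + 1) e (natEntry Ξ) (natEntry Ξ) (n * a + q)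

section triangularize

variable {n : ℕ} {Ξ V C : Matrix (Fin (n + 1)) (Fin (n + 1)) ℂ}

theorem stairDet_transform (hn : 1 ≤ n) (hV : IsLowerUni V) (hC : IsLowerUni C) {e : ℕ}
    (he : e ≤ 1) (p : ℕ) :
    stairDet (n + 1) e (natEntry (V * Ξ * shift C)) (natEntry (shift V * Ξ * C)) p =
      stairDet (n + 1) e (natEntry Ξ) (natEntry Ξ) p := by
  rw [hC.stairDet_mul_right he, hV.stairDet_mul_left hn]

/-- The minor is a quotient of two positive staircase minors. Writing s = 2a + e with e the parity
of s selects φ or ψ. -/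
theorem StairPos.det_left_pos (h : StairPos Ξ) (hn : 1 ≤ n) (hV : IsLowerUni V)
    (hC : IsLowerUni C) {m : ℕ} (hA : UpperTo m (V * Ξ * shift C))
    (hB : UpperTo m (shift V * Ξ * C)) (hmn : m ≤ n) {s q : ℕ} (hs : s ≤ m + 1) (hsn : s ≤ n)
    (hq : q ≤ s) :
    0 < (Matrix.of fun i j : Fin q => natEntry (V * Ξ * shift C) i (s - 1 - j)).det := by
  have hs2 := Nat.div_add_mod s 2
  have he : s % 2 ≤ 1 := by omega
  have key := stairDet_eq_mul_left (n := n + 1) (e := s % 2) (a := s / 2) (q := q) (by omega)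
    hA.natEntry hB.natEntry (by omega) (by omega) (by omega) (by omega)
  rw [Nat.add_sub_cancel, stairDet_transform hn hV hC he, stairDet_transform hn hV hC he, hs2] at key
  have h1 := h (s / 2) (s % 2) q he (by omega) (by omega)
  have h2 := h (s / 2) (s % 2) 0 he (by omega) (by omega)
  rw [add_zero] at h2
  rw [key, mul_comm] at h1
  exact complex_pos_of_mul_pos h1 h2

theorem StairPos.det_right_pos (h : StairPos Ξ) (hn : 1 ≤ n) (hV : IsLowerUni V)
    (hC : IsLowerUni C) {m : ℕ} (hA : UpperTo m (V * Ξ * shift C))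
    (hB : UpperTo m (shift V * Ξ * C)) (hmn : m ≤ n) {s q : ℕ} (hs : s ≤ m) (hsq : s + q ≤ n) :
    0 < (Matrix.of fun i j : Fin q => natEntry (shift V * Ξ * C) (s + 1 + i) (n - j)).det := by
  have hs2 := Nat.div_add_mod s 2
  have he : s % 2 ≤ 1 := by omega
  have key := stairDet_eq_mul_right (n := n + 1) (e := s % 2) (a := s / 2) (q := q) (by omega)
    hA.natEntry hB.natEntry (by omega) (by omega) (by omega)
  rw [Nat.add_sub_cancel, stairDet_transform hn hV hC he, stairDet_transform hn hV hC he, hs2] at key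
  have h1 := h (s / 2) (s % 2) (s + q) he (by omega) (by omega)
  have h2 := h (s / 2) (s % 2) s he (by omega) (by omega)
  rw [← add_assoc, key, mul_comm] at h1
  exact complex_pos_of_mul_pos h1 h2

theorem StairPos.exists_upperTo (h : StairPos Ξ) (hn : 1 ≤ n) : ∀ m ≤ n,
    ∃ V C, IsLowerUni V ∧ IsLowerUni C ∧ UpperTo m (V * Ξ * shift C) ∧
      UpperTo m (shift V * Ξ * C) := by
  intro m
  induction m with
  | zero =>
    intro _
    exact ⟨1, 1, .one, .one, fun _ _ h => absurd h (Nat.not_lt_zero _),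
      fun _ _ h => absurd h (Nat.not_lt_zero _)⟩
  | succ m ih =>
    intro hm
    obtain ⟨V, C, hV, hC, hA, hB⟩ := ih (by omega)
    have hdA := h.det_left_pos hn hV hC hA hB (by omega) (s := m + 1) (q := m + 1) le_rfl
      (by omega) le_rfl
    have hdB := h.det_right_pos hn hV hC hA hB (by omega) (s := m) (q := n - m) le_rfl (by omega)
    set A := V * Ξ * shift C with hAdef
    set B := shift V * Ξ * C with hBdef
    let mf : Fin (n + 1) := ⟨m, by omega⟩
    -- If the pivot vanished, the last row of the positive minor `hdA` would be zero, its other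
    -- entries being below the diagonal in cleared columns.
    have hAmm : A mf mf ≠ 0 := by
      intro h0
      refine hdA.ne' (Matrix.det_eq_zero_of_row_eq_zero (Fin.last m) fun j => ?_)
      rw [Matrix.of_apply, Fin.val_last, Nat.add_sub_cancel]
      rcases Nat.eq_zero_or_pos (j : ℕ) with hj | hj
      · rw [hj, Nat.sub_zero, natEntry_of_lt (by omega) (by omega)]; exact h0
      · exact hA.natEntry _ _ (by omega) (by omega)
    obtain ⟨y, hy⟩ := exists_sum_eq_neg B (by omega) hdB.ne'
    let C₁ := colUni (n + 1) m y
    let x : ℕ → ℂ := fun i => -(natEntry A i m / A mf mf)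
    let V₁ := colUni (n + 1) m x
    -- Clearing column m of `B` by `C₁` affects `A` through τ(C₁), which changes column m + 1 only.
    have hA₁ : ∀ i j : Fin (n + 1), (j : ℕ) ≤ m → (A * shift C₁) i j = A i j := by
      intro i j hj
      simp only [C₁, shift_colUni]
      exact mul_colUni_of_ne _ _ (by omega)
    have hB₁ : UpperTo (m + 1) (B * C₁) := by
      intro i j hj hij
      rcases Nat.lt_or_ge j m with hjm | hjm
      · rw [mul_colUni_of_ne _ _ hjm.ne]
        exact hB i j hjm hij
      · obtain rfl : j = mf := Fin.ext (by simp [mf]; omega)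
        exact (mul_colUni_same (m := m) B i (j := mf) rfl).trans (hy i hij)
    refine ⟨V₁ * V, C * C₁, (isLowerUni_colUni _ _ _).mul hV, hC.mul (isLowerUni_colUni _ _ _),
      ?_, ?_⟩
    · have e : V₁ * V * Ξ * shift (C * C₁) = V₁ * (A * shift C₁) := by
        rw [shift_mul hC, hAdef]; simp only [mul_assoc]
      rw [e]
      intro i j hj hij
      rw [Fin.lt_def] at hij
      rcases Nat.lt_or_ge m i with hi | hi
      · rw [colUni_mul_of_lt _ hi, hA₁ _ _ (by omega), hA₁ _ _ (by omega)]
        rcases Nat.lt_or_ge j m with hjm | hjm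
        · rw [hA i j hjm hij, hA _ j hjm hjm, mul_zero, add_zero]
        · obtain rfl : j = mf := Fin.ext (by simp [mf]; omega)
          have e1 : natEntry A i m = A i mf := natEntry_of_lt i.2 (by omega)
          simp only [x, e1]
          change A i mf + -(A i mf / A mf mf) * A mf mf = 0
          rw [neg_mul, div_mul_cancel₀ _ hAmm, add_neg_cancel]
      · rw [colUni_mul_of_le _ hi, hA₁ _ _ (by omega)]
        exact hA i j (by omega) hij
    · have e : shift (V₁ * V) * Ξ * (C * C₁) = shift V₁ * (B * C₁) := by
        rw [shift_mul (C := V₁) (isLowerUni_colUni _ _ _), hBdef]; simp only [mul_assoc]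
      rw [e]
      intro i j hj hij
      -- Clearing column m of `A` by `V₁` affects `B` through τ(V₁), which adds multiples of row m +
      -- 1; that row already vanishes in the columns up to m.
      simp only [V₁, shift_colUni]
      rcases Nat.lt_or_ge (m + 1) i with hi | hi
      · rw [colUni_mul_of_lt _ hi, hB₁ i j hj hij, hB₁ _ j hj hj, mul_zero, add_zero]
      · rw [colUni_mul_of_le _ hi]
        exact hB₁ i j hj hij

/-- Positivity of the trailing minors of the staircase matrix and of the corner minors implies
total positivity. -/
theorem StairPos.isRevTP (h : StairPos Ξ) (hn : 1 ≤ n)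
    (hcorner : ∀ p ≤ n + 1, 0 < (Matrix.of fun i j : Fin p => natEntry Ξ i (n - j)).det) :
    IsRevTP Ξ := by
  obtain ⟨V, C, hV, hC, hA, hB⟩ := h.exists_upperTo hn n le_rfl
  have hfull : ∀ M : Matrix (Fin (n + 1)) (Fin (n + 1)) ℂ, UpperTo n M →
      ∀ i j, j < i → M i j = 0 := fun M hM i j hij =>
    hM i j (by rw [Fin.lt_def] at hij; omega) hij
  refine IsRevTP.of_shift_mul hV hC (hfull _ hA) (hfull _ hB) ?_
  set T := shift V * Ξ * shift C with hT
  let Y : ℕ → ℕ → ℂ := fun i j => natEntry T i (n - j)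
  have hY0 : ∀ p ≤ n + 1, 0 < denseMinor Y 0 0 p := by
    intro p hp
    have h1 := hC.shift.det_natEntry_mul_right (shift V * Ξ) hp (fun i => i)
    have h2 := hV.shift.det_natEntry_mul_left Ξ hp (fun j => n - j)
    have h3 := hcorner p hp
    rw [← h2] at h3
    simp only [Nat.add_sub_cancel] at h1
    rw [← h1] at h3
    simpa [denseMinor, Y] using h3
  have hrow : ∀ c p, c + p ≤ n + 1 → 0 < denseMinor Y 0 c p := by
    intro c p hcp
    rcases Nat.eq_zero_or_pos c with rfl | hc
    · exact hY0 p (by omega)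
    · have h1 := h.det_left_pos hn hV hC hA hB le_rfl (s := n + 1 - c) (q := p) (by omega)
        (by omega) (by omega)
      -- V Ξ τ(C) and `T` differ by lower unitriangular left factors, which do not affect minors in
      -- the first p rows.
      rw [mul_assoc, hV.det_natEntry_mul_left _ (by omega),
        ← hV.shift.det_natEntry_mul_left _ (by omega), ← mul_assoc] at h1
      convert h1 using 1
      unfold denseMinor
      congr 1; ext i j
      simp only [Matrix.of_apply, Y, zero_add]
      congr 1; omega
  have hcol : ∀ r p, r + p ≤ n + 1 → 0 < denseMinor Y r 0 p := by
    intro r p hrp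
    rcases Nat.eq_zero_or_pos r with rfl | hr
    · exact hY0 p (by omega)
    · rcases Nat.eq_zero_or_pos p with rfl | hp
      · simp [denseMinor]
      have h1 := h.det_right_pos hn hV hC hA hB le_rfl (s := r - 1) (q := p) (by omega) (by omega)
      -- τ(V) Ξ C and `T` differ by lower unitriangular right factors, which do not affect minors in
      -- the last p columns.
      have h2 := hC.det_natEntry_mul_right (shift V * Ξ) (p := p) (by omega)
        (fun i => r - 1 + 1 + i)
      have h3 := hC.shift.det_natEntry_mul_right (shift V * Ξ) (p := p) (by omega)
        (fun i => r - 1 + 1 + i)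
      simp only [Nat.add_sub_cancel] at h2 h3
      rw [h2, ← h3, Nat.sub_add_cancel hr] at h1
      simpa [denseMinor, Y] using h1
  have hdense := denseMinor_pos_of_initial hrow hcol
  intro m r c hr hc
  have key := det_pos_of_denseMinor_pos hdense (r := fun a : Fin m => ((r a.rev).rev : ℕ))
    (c := fun a : Fin m => n - (c a.rev : ℕ))
    (fun a b hab => Fin.rev_lt_rev.mpr (hr (Fin.rev_lt_rev.mpr hab)))
    (fun a b hab => by
      have h1 := hc (Fin.rev_lt_rev.mpr hab)
      rw [Fin.lt_def] at h1
      dsimp only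
      omega) (fun a => Fin.is_lt _) (fun a => by omega)
  -- `Y` has reversed columns whereas `IsRevTP` reverses rows; reversing the order of both
  -- selections leaves the minor unchanged.
  rw [← det_submatrix_rev_rev (T.submatrix Fin.rev id)]
  convert key using 2
  ext a b
  simp only [Matrix.submatrix_apply, Matrix.of_apply, Function.comp, id_eq, Y]
  rw [show n - (n - (c b.rev : ℕ)) = c b.rev by omega, natEntry_val]

end triangularize

/-! ### The initial cluster in terms of staircase determinants -/

theorem blockNo_mul_sub {d k t : ℕ} (ht : t < k * d) : blockNo d (k * d - t) = k - t / d := by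
  have hd : 0 < d := Nat.pos_of_ne_zero fun h => by simp [h] at ht
  have h1 := Nat.div_add_mod t d
  have h2 := Nat.mod_lt t hd
  have h3 : t / d < k := Nat.div_lt_of_lt_mul (by rwa [mul_comm])
  obtain ⟨m, hm⟩ : ∃ m, k = t / d + 1 + m := ⟨k - (t / d + 1), by omega⟩
  have h4 : k * d - t - 1 = d * m + (d - 1 - t % d) := by
    have : k * d = d * (t / d) + d + d * m := by rw [hm]; ring
    omega
  rw [blockNo, h4, Nat.mul_add_div hd, Nat.div_eq_of_lt (by omega)]
  omega

theorem inBlock_mul_sub {d k t : ℕ} (ht : t < k * d) : inBlock d (k * d - t) = d - t % d := by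
  have hd : 0 < d := Nat.pos_of_ne_zero fun h => by simp [h] at ht
  have h1 := Nat.div_add_mod t d
  have h2 := Nat.mod_lt t hd
  have h3 : t / d < k := Nat.div_lt_of_lt_mul (by rwa [mul_comm])
  obtain ⟨m, hm⟩ : ∃ m, k = t / d + 1 + m := ⟨k - (t / d + 1), by omega⟩
  have h4 : k * d - t - 1 = d * m + (d - 1 - t % d) := by
    have : k * d = d * (t / d) + d + d * m := by rw [hm]; ring
    omega
  rw [inBlock, h4, Nat.mul_add_mod, Nat.mod_eq_of_lt (by omega)]
  omega

theorem natEntry_submatrix_rev {n : ℕ} (X : Matrix (Fin n) (Fin n) ℂ) (s j : ℕ) :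
    natEntry (X.submatrix Fin.rev id) s j = entry X (n - s) (j + 1) := by
  by_cases h : s < n ∧ j < n
  · rw [natEntry_of_lt h.1 h.2, entry, dif_pos (by omega)]
    simp only [Matrix.submatrix_apply, id_eq]
    congr 1
  · rw [natEntry_eq_zero (by omega), entry, dif_neg (by omega)]

theorem entry_eq_zero {n : ℕ} {X : Matrix (Fin n) (Fin n) ℂ} {i j : ℕ} (h : i = 0 ∨ j = 0) :
    entry X i j = 0 := dif_neg (by omega)

theorem cgU_eq_stair {n : ℕ} (X : Matrix (Fin n) (Fin n) ℂ) {k e t u : ℕ} (he : e ≤ 1)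
    (ht : t < k * (n - 1)) (hu : u < k * (n + 1)) :
    cgU X X (k * (n - 1) - t) (k * (n + 1) + e - u) =
      stair n e (natEntry (X.submatrix Fin.rev id)) (natEntry (X.submatrix Fin.rev id)) t u := by
  have hd : 0 < n - 1 := Nat.pos_of_ne_zero fun h => by simp [h] at ht
  have hu' : u + (n + 1) - e < (k + 1) * (n + 1) := by rw [add_one_mul]; omega
  have hc : k * (n + 1) + e - u = (k + 1) * (n + 1) - (u + (n + 1) - e) := by
    rw [add_one_mul]; omega
  rw [hc, cgU, blockNo_mul_sub ht, inBlock_mul_sub ht, blockNo_mul_sub hu', inBlock_mul_sub hu',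
    stair, stairEntry]
  have ha : t / (n - 1) < k := Nat.div_lt_of_lt_mul (by rwa [mul_comm])
  have hb : (u + (n + 1) - e) / (n + 1) < k + 1 := Nat.div_lt_of_lt_mul (by rwa [mul_comm])
  have ho := Nat.mod_lt t hd
  have hw := Nat.mod_lt (u + (n + 1) - e) n.succ_pos
  generalize t / (n - 1) = a at *
  generalize (u + (n + 1) - e) / (n + 1) = b at *
  generalize t % (n - 1) = o at *
  generalize (u + (n + 1) - e) % (n + 1) = w at *
  simp only [natEntry_submatrix_rev, calX, calY]
  by_cases h1 : b = a + 1
  · rw [if_pos (by omega), if_pos h1]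
    split_ifs with h
    · congr 1 <;> omega
    · exact entry_eq_zero (by omega)
  · rw [if_neg (by omega), if_neg h1]
    by_cases h2 : b = a
    · rw [if_pos (by omega), if_pos h2]
      congr 1 <;> omega
    · rw [if_neg (by omega), if_neg h2]

theorem denseMinor_eq_det_rev (A : ℕ → ℕ → ℂ) (r c p : ℕ) :
    denseMinor A (r - p + 1) (c - p + 1) p =
      (Matrix.of fun t u : Fin p => A (r - p + p - t) (c - p + p - u)).det := by
  rw [denseMinor, ← Matrix.det_submatrix_equiv_self Fin.revPerm]
  congr 1
  ext t u
  simp only [Matrix.submatrix_apply, Matrix.of_apply, Fin.revPerm_apply, Fin.val_rev]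
  congr 1 <;> omega

theorem phi_fn_eq_stairDet {n p : ℕ} (X : Matrix (Fin n) (Fin n) ℂ) (hp : p ≤ cgN n) :
    (CGName.phi p).fn X X = stairDet n 0 (natEntry (X.submatrix Fin.rev id))
      (natEntry (X.submatrix Fin.rev id)) p := by
  have h1 : cgk n * (n - 1) ≤ cgk n * (n + 1) := Nat.mul_le_mul_left _ (by omega)
  rw [cgN] at hp
  rw [CGName.fn, denseMinor_eq_det_rev, stairDet, cgN]
  congr 1
  ext t u
  rw [Matrix.of_apply, Matrix.of_apply, ← cgU_eq_stair X (k := cgk n) zero_le_one (by omega)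
    (by omega)]
  congr 1 <;> omega

theorem psi_fn_eq_stairDet {n p : ℕ} (X : Matrix (Fin n) (Fin n) ℂ) (hp : p ≤ cgN n) :
    (CGName.psi p).fn X X = stairDet n 1 (natEntry (X.submatrix Fin.rev id))
      (natEntry (X.submatrix Fin.rev id)) p := by
  have h1 : cgk n * (n - 1) ≤ cgk n * (n + 1) := Nat.mul_le_mul_left _ (by omega)
  rw [cgN] at hp
  rw [CGName.fn, show cgk n * (n + 1) - p + 2 = cgk n * (n + 1) + 1 - p + 1 by omega,
    denseMinor_eq_det_rev, stairDet, cgN]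
  congr 1
  ext t u
  rw [Matrix.of_apply, Matrix.of_apply, ← cgU_eq_stair X (k := cgk n) le_rfl (by omega)
    (by omega)]
  congr 1 <;> omega

theorem theta_fn_eq_det {n p : ℕ} (X : Matrix (Fin (n + 1)) (Fin (n + 1)) ℂ) (hp : p ≤ n + 1) :
    (CGName.theta p).fn X X =
      (Matrix.of fun i j : Fin p => natEntry (X.submatrix Fin.rev id) i (n - j)).det := by
  rw [CGName.fn, denseMinor_eq_det_rev]
  congr 1
  ext t u
  rw [Matrix.of_apply, Matrix.of_apply, natEntry_submatrix_rev]
  congr 1 <;> omega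

theorem cgM_le_cgN (n : ℕ) : cgM n ≤ cgN n := by
  rw [cgM]; split_ifs <;> omega

theorem mul_add_le_cgN {n a q : ℕ} (ha : 2 * a ≤ n) (hq : q ≤ n) : n * a + q ≤ cgN (n + 1) := by
  rw [cgN, cgk, Nat.add_sub_cancel]
  calc n * a + q ≤ (a + 1) * n := by rw [add_one_mul, mul_comm]; omega
    _ ≤ _ := Nat.mul_le_mul_right _ (by omega)

/-- When n + 1 is odd, M is only (k - 1) n; but then n is even, so 2a + 1 ≤ n improves to 2a + 2 ≤
n. -/
theorem mul_add_le_cgM {n a q : ℕ} (ha : 2 * a + 1 ≤ n) (hq : q ≤ n) :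
    n * a + q ≤ cgM (n + 1) := by
  rw [cgM]
  split_ifs with h
  · exact mul_add_le_cgN (by omega) hq
  · rw [Nat.not_even_iff_odd] at h
    obtain ⟨m, hm⟩ := h
    rw [cgN, cgk, Nat.add_sub_cancel, ← Nat.sub_one_mul]
    calc n * a + q ≤ (a + 1) * n := by rw [add_one_mul, mul_comm]; omega
      _ ≤ _ := Nat.mul_le_mul_right _ (by omega)

theorem stairPos_of_mem_TPCG {n : ℕ} {X : GL (Fin (n + 1)) ℂ} (hX : X ∈ TPCG (n + 1)) :
    StairPos ((X : Matrix (Fin (n + 1)) (Fin (n + 1)) ℂ).submatrix Fin.rev id) := by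
  intro a e q he ha hq
  rcases Nat.eq_zero_or_pos (n * a + q) with h0 | h0
  · rw [h0]; simp [stairDet]
  · obtain rfl | rfl : e = 0 ∨ e = 1 := by omega
    · have h1 : n * a + q ≤ cgN (n + 1) := mul_add_le_cgN (by omega) hq
      rw [← phi_fn_eq_stairDet _ h1]
      exact phi_pos hX h0 h1
    · have h1 : n * a + q ≤ cgM (n + 1) := mul_add_le_cgM ha hq
      rw [← psi_fn_eq_stairDet _ (h1.trans (cgM_le_cgN _))]
      exact psi_pos hX h0 h1

theorem TPCG_subset_TP {n : ℕ} (hn : 1 ≤ n) : TPCG (n + 1) ⊆ TP (n + 1) := by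
  intro X hX m r c
  have h := (stairPos_of_mem_TPCG hX).isRevTP hn fun p hp => by
    rcases Nat.eq_zero_or_pos p with rfl | h0
    · simp
    · rw [← theta_fn_eq_det _ hp]
      exact theta_pos hX h0 hp
  have h1 := h m r c r.strictMono c.strictMono
  simpa [Matrix.submatrix_submatrix, Function.comp_def] using h1

/-! ### A totally positive matrix outside the Cremmer–Gervais positive locus -/

/-- The totally positive matrix with entries `2 ^ (i j)`. -/
noncomputable def powMatrix (n : ℕ) : Matrix (Fin n) (Fin n) ℂ := Matrix.of fun i j => 2 ^ ((i : ℕ) * j)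

/-- Up to positive row factors 2^((r+s)c) this is a Vandermonde determinant with increasing nodes
2^(r+s). -/
theorem denseMinor_two_pow_pos (r c p : ℕ) :
    0 < denseMinor (fun i j => (2 : ℂ) ^ (i * j)) r c p := by
  have h2 : (0 : ℂ) < 2 := by norm_num
  have : (Matrix.of fun s t : Fin p => (2 : ℂ) ^ ((r + s) * (c + t))) =
      Matrix.of fun s t : Fin p => (2 : ℂ) ^ ((r + s) * c) *
        Matrix.vandermonde (fun s : Fin p => (2 : ℂ) ^ (r + (s : ℕ))) s t := by
    ext s t
    rw [Matrix.of_apply, Matrix.of_apply, Matrix.vandermonde_apply, ← pow_mul, ← pow_add, mul_add]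
  rw [denseMinor, this, Matrix.det_mul_column, Matrix.det_vandermonde]
  refine mul_pos (Finset.prod_pos fun s _ => pow_pos h2 _)
    (Finset.prod_pos fun s _ => Finset.prod_pos fun t ht => ?_)
  rw [Finset.mem_Ioi, Fin.lt_def] at ht
  exact sub_pos.mpr (pow_lt_pow_right₀ (by norm_num) (by omega))

theorem det_submatrix_powMatrix_pos {n m : ℕ} {r c : Fin m → Fin n} (hr : StrictMono r)
    (hc : StrictMono c) : 0 < ((powMatrix n).submatrix r c).det :=
  det_pos_of_denseMinor_pos (a := n) (b := n) (fun _ _ _ _ _ => denseMinor_two_pow_pos _ _ _)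
    (r := fun i => (r i : ℕ)) (c := fun i => (c i : ℕ)) hr hc (fun i => (r i).2) fun i => (c i).2

theorem det_powMatrix_pos (n : ℕ) : 0 < (powMatrix n).det := by
  simpa using det_submatrix_powMatrix_pos (n := n) strictMono_id strictMono_id

/-- The matrix with entries `2 ^ (i j)` as an element of `GL_n`. -/
noncomputable def powGL (n : ℕ) : GL (Fin n) ℂ :=
  Matrix.GeneralLinearGroup.mkOfDetNeZero (powMatrix n) (det_powMatrix_pos n).ne'

theorem powGL_mem_TP (n : ℕ) : powGL n ∈ TP n := fun _ r c =>
  det_submatrix_powMatrix_pos r.strictMono c.strictMono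

theorem two_le_cgM {n : ℕ} (hn : 2 ≤ n) : 2 ≤ cgM (n + 1) := by
  have := mul_add_le_cgM (n := n) (a := 0) (q := n) (by omega) le_rfl
  omega

/-- Its columns are the first of an 𝒳 block and the last of the adjacent 𝒴 block, whose rows are
offset by one. The result is not a minor of `X`, so total positivity does not fix its sign. -/
theorem stairDet_one_two {n : ℕ} (hn : 2 ≤ n) (A B : ℕ → ℕ → ℂ) :
    stairDet (n + 1) 1 A B 2 = A 0 0 * B 2 n - B 1 n * A 1 0 := by
  have h1 : (0 + (n + 1 + 1) - 1) / (n + 1 + 1) = 0 := Nat.div_eq_of_lt (by omega)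
  have h2 : (0 + (n + 1 + 1) - 1) % (n + 1 + 1) = n + 1 := by
    rw [Nat.mod_eq_of_lt (by omega)]; omega
  have h3 : (1 + (n + 1 + 1) - 1) / (n + 1 + 1) = 1 := by
    rw [Nat.add_sub_cancel_left]; exact Nat.div_self (by omega)
  have h4 : (1 + (n + 1 + 1) - 1) % (n + 1 + 1) = 0 := by
    rw [Nat.add_sub_cancel_left]; exact Nat.mod_self _
  have h5 : 1 / n = 0 := Nat.div_eq_of_lt (by omega)
  have h6 : 1 % n = 1 := Nat.mod_eq_of_lt (by omega)
  simp only [stairDet, Matrix.det_fin_two, Matrix.of_apply, Fin.val_zero, Fin.val_one, stair,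
    h1, h2, h3, h4, Nat.add_sub_cancel, Nat.zero_div, Nat.zero_mod, h5, h6, stairEntry]
  simp

theorem powGL_notMem_TPCG {n : ℕ} (hn : 2 ≤ n) : powGL (n + 1) ∉ TPCG (n + 1) := by
  intro h
  have h1 := psi_pos h one_le_two (two_le_cgM hn)
  rw [psi_fn_eq_stairDet _ ((two_le_cgM hn).trans (cgM_le_cgN _)), stairDet_one_two hn,
    show ((powGL (n + 1) : GL (Fin (n + 1)) ℂ) : Matrix (Fin (n + 1)) (Fin (n + 1)) ℂ) =
      powMatrix (n + 1) from rfl,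
    natEntry_of_lt (by omega) (by omega), natEntry_of_lt (by omega) (by omega),
    natEntry_of_lt (by omega) (by omega), natEntry_of_lt (by omega) (by omega)] at h1
  simp only [powMatrix, Matrix.submatrix_apply, Matrix.of_apply, Fin.val_rev, id_eq, mul_zero,
    pow_zero, one_mul, mul_one, sub_pos] at h1
  -- For this matrix ψ₂ equals 2^((n-2)n) - 2^((n-1)n).
  refine h1.not_ge (pow_le_pow_right₀ one_le_two (Nat.mul_le_mul_right n ?_))
  omega

theorem theorem5p1 (n : ℕ) (hn : 3 ≤ n) : TPCG n ⊂ TP n := by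
  obtain ⟨n, rfl⟩ : ∃ m, n = m + 1 := ⟨n - 1, by omega⟩
  exact ⟨TPCG_subset_TP (by omega), fun h => powGL_notMem_TPCG (by omega) (h (powGL_mem_TP _))⟩
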